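/- All graphs are finite and simple. For a graph $G=(V,E)$ with $V=[N]$, $N\ge 1$, let $\alpha(G)$ be its stability number (maximum size of a set of pairwise non-adjacent vertices), $A_G$ its adjacency matrix, and $I$, $J$ the identity and all-ones matrices. For an integer $r\ge 0$ let $$\mathcal K^{(r)}_N=\Big\{M\in\mathbb R^{N\times N}\text{ symmetric}: \Big(\sum_{i=1}^N x_i^2\Big)^r\sum_{i,j=1}^N M_{ij}x_i^2x_j^2 \text{ is a sum of squares of polynomials in }\mathbb R[x_1,\dots,x_N]\Big\},$$ let $\vartheta^{(r)}(G)=\min\{t\in\mathbb R : t(A_G+I)-J\in\mathcal K^{(r)}_N\}$, and let the $\vartheta$-rank of $G$, written $\vartheta\text{-rank}(G)$, be the smallest integer $r\ge 0$ with $\vartheta^{(r)}(G)=\alpha(G)$, or $\infty$ if there is no such $r$. Let $G\oplus H$ denote the disjoint union of $G$ and $H$, $C_k$ the cycle on $k$ vertices, $\overline G$ the complement of $G$, and $\overline{K_m}$ the graph with $m$ vertices and no edges ($m\ge 0$). **Corollary.** For all integers $n\ge 2$ and $m\ge 0$: (i) $\vartheta\text{-rank}(C_{2n+1}\oplus\overline{K_m})=1$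 if and only if $m\le 4+\frac{4}{n-1}$; (ii) $\vartheta\text{-rank}(\overline{C_{2n+1}}\oplus\overline{K_m})=1$ if and only if $m\le 8$. For example, $\vartheta\text{-rank}(C_5\oplus\overline{K_8})=1$, while $\vartheta\text{-rank}(C_5\oplus\overline{K_9})\ge 2$. In particular, adding an isolated node can increase the $\vartheta$-rank: it is not true that $\vartheta\text{-rank}(G\oplus i_0)\le\vartheta\text{-rank}(G)$ for every graph $G$ with at least one vertex, where $G\oplus i_0$ denotes $G$ with one isolated node $i_0$ added. This refutes a conjecture of Gvozdenović and Laurent. -/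

import Mathlib

open scoped SimpleGraph

/-- The form `(x^{∘2})ᵀ M x^{∘2} = ∑ i j, M i j * x_i ^ 2 * x_j ^ 2` as a real polynomial. -/
noncomputable def squaredForm {V : Type*} [Fintype V] (M : Matrix V V ℝ) : MvPolynomial V ℝ :=
  ∑ i, ∑ j, MvPolynomial.C (M i j) * MvPolynomial.X i ^ 2 * MvPolynomial.X j ^ 2

/-- Parrilo's cone `𝒦^(r)`: the symmetric matrices `M` such that
`(∑ i, x_i ^ 2) ^ r * (x^{∘2})ᵀ M x^{∘2}` is a sum of squares of real polynomials. -/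
def parriloCone (V : Type*) [Fintype V] (r : ℕ) : Set (Matrix V V ℝ) :=
  {M | M.IsSymm ∧
    IsSumSq ((∑ i : V, (MvPolynomial.X i : MvPolynomial V ℝ) ^ 2) ^ r * squaredForm M)}

open Classical in
/-- The matrix `t (A_G + I) - J`, with `J` the all-ones matrix. -/
noncomputable def thetaMatrix {V : Type*} [Fintype V] (G : SimpleGraph V) (t : ℝ) :
    Matrix V V ℝ :=
  t • (G.adjMatrix ℝ + 1) - Matrix.of (fun _ _ => 1)

/-- `ϑ^(r)(G) = t`, that is, `t = min {s : s (A_G + I) - J ∈ 𝒦^(r)}` (an attained minimum). -/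
def IsTheta {V : Type*} [Fintype V] (G : SimpleGraph V) (r : ℕ) (t : ℝ) : Prop :=
  IsLeast {s : ℝ | thetaMatrix G s ∈ parriloCone V r} t

/-- The `ϑ`-rank of `G`: the least `r` with `ϑ^(r)(G) = α(G)`, and `⊤` if there is none. -/
noncomputable def thetaRank {V : Type*} [Fintype V] (G : SimpleGraph V) : ℕ∞ :=
  ⨅ (r : ℕ) (_ : IsTheta G r (G.indepNum : ℝ)), (r : ℕ∞)

/-!
Write `α` for the stability number of a graph, `M` for the matrix `α (A + I) - J`, and
`y i = x i ^ 2`. Evaluating at indicator vectors of stable sets shows that every value feasible for `ϑ^(r)` is at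
least `α`, so `ϑ^(r) = α` exactly when `M` lies in the `r`-th cone (`isTheta_indepNum_iff`).

Both families of graphs are of the form `G ⊕ K̄_m`, where `G` has stability number `a = b + 1 ≥ 2`
and
* the vertices outside the closed neighbourhood of any vertex are covered by `b` cliques;
* a function on the vertices whose sum is the same on all maximum stable sets is constant.
For an odd cycle on `2 n + 1` vertices `a = n`, for its complement `a = 2`. For every such `G` the
rank of `G ⊕ K̄_m` is `1` if and only if `m (a - 1) ≤ 4 a` (`thetaRank_sum_bot_eq_one_iff`).

*Necessity.* The polynomials in a sum of squares representing a form of degree `2 d` may be taken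
homogeneous of degree `d`. Averaging over sign changes of the variables isolates, in level zero, the
part `∑ j, L j * y j` of each quadratic and, in level one, the parts `x i * ∑ j, l i j * y j` of
each cubic. The form of `M` vanishes at the indicator vectors of maximum stable sets, so the linear
forms vanish there too, and the second property of `G` makes their coefficients constant on `G` in
level zero (and in level one for the forms attached to an isolated node). In level zero the common
value contradicts the values of `M` at a pair of nonadjacent vertices (`not_mem_parriloCone_zero`).
In level one the Cauchy–Schwarz inequality between the coefficient `l i i` and the sum of the
`l i s` over the isolated nodes `s` becomes `(a m (α - 3) - m ^ 2) ^ 2 ≤ 4 a ^ 3 m (α - 1)` with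
`α = a + m`, and the difference of the two sides is `b m (m b - 4 a) (m + a) ^ 2`
(`mul_le_of_mem_parriloCone_one`).

*Sufficiency.* A certificate for level one is a family of matrices `P i` whose forms are sums of
squares and with `P i j k + P j i k + P k i j ≤ M i j + M j k + M i k`
(`mem_parriloCone_one_of_certificate`). The matrix of a vertex of `G` is constant on the blocks
given by its closed neighbourhood and the cliques covering the rest (`exists_vertex_certificate`);
the only condition for it to be positive semidefinite is the same polynomial inequality.

Finally `C₅ ⊕ K̄₈` has rank `1` and `C₅ ⊕ K̄₉` does not, so an isolated node can increase the rank.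
-/

open MvPolynomial Finset

/-! ### Sums of squares of homogeneous polynomials -/

theorem IsSumSq.exists_fin {R : Type*} [CommSemiring R] {p : R} (h : IsSumSq p) :
    ∃ (n : ℕ) (q : Fin n → R), p = ∑ r, q r ^ 2 := by
  induction h with
  | zero => exact ⟨0, Fin.elim0, by simp⟩
  | sq_add a _ ih =>
    obtain ⟨n, q, rfl⟩ := ih
    exact ⟨n + 1, Fin.cons a q, by simp [Fin.sum_univ_succ, sq]⟩

/-- If `q` has no component of degree less than `e`, then the component of degree `2 * e` of
`q ^ 2` is the square of the component of degree `e` of `q`. -/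
theorem coeff_sq_of_low_components {σ : Type*} {q : MvPolynomial σ ℝ} {e : ℕ}
    (hq : ∀ k < e, homogeneousComponent k q = 0) {γ : σ →₀ ℕ} (hγ : γ.degree = 2 * e) :
    coeff γ (q ^ 2) = coeff γ (homogeneousComponent e q ^ 2) := by
  classical
  have low : ∀ β : σ →₀ ℕ, β.degree < e → coeff β q = 0 := fun β hβ => by
    have := coeff_homogeneousComponent (φ := q) β.degree β
    rw [hq _ hβ] at this
    simpa using this.symm
  rw [sq, sq, coeff_mul, coeff_mul]
  refine sum_congr rfl fun x hx => ?_
  have hx' : x.1.degree + x.2.degree = 2 * e := by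
    rw [← hγ, ← mem_antidiagonal.1 hx, map_add]
  rw [coeff_homogeneousComponent, coeff_homogeneousComponent]
  rcases lt_trichotomy x.1.degree e with h | h | h
  · rw [low _ h, if_neg h.ne]; simp
  · rw [if_pos h, if_pos (by omega)]
  · rw [low x.2 (by omega), if_neg h.ne']; simp

/-- A homogeneous sum of squares of degree `2 * d` is a sum of squares of homogeneous polynomials
of degree `d`: over `ℝ` the components of lower degree must cancel. -/
theorem IsSumSq.exists_homogeneous {σ : Type*} {p : MvPolynomial σ ℝ} {d : ℕ}
    (h : IsSumSq p) (hp : p.IsHomogeneous (2 * d)) :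
    ∃ (n : ℕ) (q : Fin n → MvPolynomial σ ℝ), (∀ r, (q r).IsHomogeneous d) ∧
      p = ∑ r, q r ^ 2 := by
  obtain ⟨n, q, rfl⟩ := h.exists_fin
  have hom : ∀ e, (∑ r, homogeneousComponent e (q r) ^ 2).IsHomogeneous (2 * e) := fun e =>
    IsHomogeneous.sum _ _ _ fun r _ => by
      rw [mul_comm]; exact (homogeneousComponent_isHomogeneous e (q r)).pow 2
  have low : ∀ e < d, ∀ r, homogeneousComponent e (q r) = 0 := by
    intro e
    induction e using Nat.strong_induction_on with
    | _ e ih =>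
      intro he
      have hz : ∑ r, homogeneousComponent e (q r) ^ 2 = 0 := by
        ext γ
        by_cases hγ : γ.degree = 2 * e
        · have h0 := hp.coeff_eq_zero (d := γ) (by omega)
          rw [coeff_sum] at h0 ⊢
          rw [coeff_zero, ← h0]
          exact sum_congr rfl fun r _ =>
            (coeff_sq_of_low_components (fun k hk => ih k hk (hk.trans he) r) hγ).symm
        · rw [(hom e).coeff_eq_zero hγ, coeff_zero]
      intro r
      refine MvPolynomial.funext fun x => ?_
      have hx := congrArg (eval x) hz
      simp only [map_sum, map_pow, map_zero] at hx
      have := (sum_eq_zero_iff_of_nonneg fun r _ => sq_nonneg _).1 hx r (mem_univ r)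
      simpa using this
  refine ⟨n, fun r => homogeneousComponent d (q r),
    fun r => homogeneousComponent_isHomogeneous d (q r), ?_⟩
  ext γ
  by_cases hγ : γ.degree = 2 * d
  · rw [coeff_sum, coeff_sum]
    exact sum_congr rfl fun r _ => coeff_sq_of_low_components (fun k hk => low k hk r) hγ
  · rw [hp.coeff_eq_zero hγ, (hom d).coeff_eq_zero hγ]

/-- The value of the quadratic form of `M` at the entrywise square of `x`. -/
theorem eval_squaredForm {V : Type*} [Fintype V] (M : Matrix V V ℝ) (x : V → ℝ) :
    eval x (squaredForm M) = ∑ i, ∑ j, M i j * x i ^ 2 * x j ^ 2 := by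
  simp [squaredForm]

theorem isHomogeneous_squaredForm {V : Type*} [Fintype V] (M : Matrix V V ℝ) :
    (squaredForm M).IsHomogeneous 4 :=
  IsHomogeneous.sum _ _ _ fun i _ => IsHomogeneous.sum _ _ _ fun j _ =>
    (((isHomogeneous_X_pow i 2).C_mul (M i j)).mul (isHomogeneous_X_pow j 2))

/-- The polynomials in a certificate of membership in the cone of level `r` can be taken homogeneous
of degree `r + 2`; the identity is recorded for the polynomial functions. -/
theorem exists_eval_of_mem_parriloCone {V : Type*} [Fintype V] {M : Matrix V V ℝ} {r : ℕ}
    (h : M ∈ parriloCone V r) :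
    ∃ (n : ℕ) (q : Fin n → MvPolynomial V ℝ), (∀ k, (q k).IsHomogeneous (r + 2)) ∧
      ∀ x : V → ℝ, (∑ i, x i ^ 2) ^ r * ∑ i, ∑ j, M i j * x i ^ 2 * x j ^ 2 =
        ∑ k, eval x (q k) ^ 2 := by
  have hom : ((∑ i : V, (X i : MvPolynomial V ℝ) ^ 2) ^ r * squaredForm M).IsHomogeneous
      (2 * (r + 2)) := by
    have h1 : (∑ i : V, (X i : MvPolynomial V ℝ) ^ 2).IsHomogeneous 2 :=
      IsHomogeneous.sum _ _ _ fun i _ => isHomogeneous_X_pow i 2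
    have := (h1.pow r).mul (isHomogeneous_squaredForm M)
    rwa [show 2 * r + 4 = 2 * (r + 2) by ring] at this
  obtain ⟨n, q, hq, he⟩ := h.2.exists_homogeneous hom
  refine ⟨n, q, hq, fun x => ?_⟩
  have := congrArg (eval x) he
  simpa [eval_squaredForm] using this

/-! ### Averaging over signs -/

theorem Finsupp.exists_single_of_degree_eq_one {V : Type*} {γ : V →₀ ℕ} (h : γ.degree = 1) :
    ∃ j, γ = Finsupp.single j 1 := by
  exact (Finsupp.sum_eq_one_iff γ).1 h

/-- The indicator vector of `U`, with signs `ε`. -/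
def signedIndicator {V : Type*} [DecidableEq V] (U : Finset V) (ε : V → ℤˣ) (i : V) : ℝ :=
  ((ε i : ℤ) : ℝ) * if i ∈ U then 1 else 0

theorem signedIndicator_sq {V : Type*} [DecidableEq V] (U : Finset V) (ε : V → ℤˣ) (i : V) :
    signedIndicator U ε i ^ 2 = if i ∈ U then 1 else 0 := by
  unfold signedIndicator
  rcases Int.units_eq_one_or (ε i) with h | h <;> split_ifs <;> simp [h]

section Signs

variable {V : Type*} [Fintype V] [DecidableEq V]

theorem sum_units_pow (k : ℕ) :
    ∑ u : ℤˣ, (((u : ℤ) : ℝ)) ^ k = if Even k then 2 else 0 := by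
  have : (univ : Finset ℤˣ) = {1, -1} := rfl
  rw [this, sum_pair (by decide)]
  split_ifs with h
  · simp [h.neg_pow]; norm_num
  · simp [(Nat.not_even_iff_odd.1 h).neg_pow]

/-- Orthogonality of the characters of the sign group. -/
theorem sum_signs_prod_pow (γ : V → ℕ) :
    ∑ ε : V → ℤˣ, ∏ i, ((ε i : ℤ) : ℝ) ^ γ i =
      if ∀ i, Even (γ i) then 2 ^ Fintype.card V else 0 := by
  have h := prod_univ_sum (fun _ : V => (univ : Finset ℤˣ)) (fun i u => ((u : ℤ) : ℝ) ^ γ i)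
  rw [Fintype.piFinset_univ] at h
  rw [← h]
  simp_rw [sum_units_pow]
  split_ifs with h'
  · simp [h']
  · push Not at h'
    obtain ⟨i, hi⟩ := h'
    exact prod_eq_zero (mem_univ i) (by simpa using hi)

theorem sum_signs_mul (i j : V) :
    ∑ ε : V → ℤˣ, ((ε i : ℤ) : ℝ) * ((ε j : ℤ) : ℝ) =
      if i = j then 2 ^ Fintype.card V else 0 := by
  have h := sum_signs_prod_pow (fun k : V => (if k = i then 1 else 0) + if k = j then 1 else 0)
  simp only [pow_add, prod_mul_distrib, pow_ite, pow_one, pow_zero, prod_ite_eq', mem_univ,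
    if_true] at h
  rw [h]
  refine if_congr ⟨fun h => ?_, ?_⟩ rfl rfl
  · by_contra hij
    have := h i
    simp [hij] at this
  · rintro rfl k
    split_ifs <;> decide

/-- Bessel's inequality for the coordinate characters of the sign group. -/
theorem sum_sq_sum_signs_le (U : Finset V) (g : (V → ℤˣ) → ℝ) :
    ∑ i ∈ U, (∑ ε, ((ε i : ℤ) : ℝ) * g ε) ^ 2 ≤ 2 ^ Fintype.card V * ∑ ε, g ε ^ 2 := by
  set A : ℝ := 2 ^ Fintype.card V with hA
  have hA0 : 0 < A := by positivity
  set c : V → ℝ := fun i => ∑ ε, ((ε i : ℤ) : ℝ) * g ε with hc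
  have h0 : 0 ≤ ∑ ε, (A * g ε - ∑ i ∈ U, c i * ((ε i : ℤ) : ℝ)) ^ 2 :=
    sum_nonneg fun _ _ => sq_nonneg _
  have h1 : ∑ ε, g ε * ∑ i ∈ U, c i * ((ε i : ℤ) : ℝ) = ∑ i ∈ U, c i ^ 2 := by
    simp_rw [mul_sum]
    rw [sum_comm]
    refine sum_congr rfl fun i _ => ?_
    rw [sq]
    nth_rewrite 3 [hc]
    rw [mul_sum]
    exact sum_congr rfl fun ε _ => by ring
  have h2 : ∑ ε : V → ℤˣ, (∑ i ∈ U, c i * ((ε i : ℤ) : ℝ)) ^ 2 = A * ∑ i ∈ U, c i ^ 2 := by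
    simp_rw [sq, sum_mul_sum]
    rw [sum_comm, mul_sum]
    refine sum_congr rfl fun i hi => ?_
    rw [sum_comm]
    have : ∀ j ∈ U, ∑ ε : V → ℤˣ, c i * ((ε i : ℤ) : ℝ) * (c j * ((ε j : ℤ) : ℝ)) =
        if i = j then c i * c j * A else 0 := fun j _ => by
      have : ∑ ε : V → ℤˣ, c i * ((ε i : ℤ) : ℝ) * (c j * ((ε j : ℤ) : ℝ)) =
          c i * c j * ∑ ε : V → ℤˣ, ((ε i : ℤ) : ℝ) * ((ε j : ℤ) : ℝ) := by
        rw [mul_sum]; exact sum_congr rfl fun ε _ => by ring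
      rw [this, sum_signs_mul]; split_ifs <;> simp [hA]
    rw [sum_congr rfl this, sum_ite_eq, if_pos hi]; ring
  have h3 : ∑ ε, (A * g ε - ∑ i ∈ U, c i * ((ε i : ℤ) : ℝ)) ^ 2 =
      A ^ 2 * ∑ ε, g ε ^ 2 - 2 * A * (∑ ε, g ε * ∑ i ∈ U, c i * ((ε i : ℤ) : ℝ)) +
        ∑ ε : V → ℤˣ, (∑ i ∈ U, c i * ((ε i : ℤ) : ℝ)) ^ 2 := by
    rw [mul_sum, mul_sum, ← sum_sub_distrib, ← sum_add_distrib]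
    exact sum_congr rfl fun ε _ => by ring
  rw [h3, h1, h2] at h0
  have h4 : 0 ≤ A * (A * ∑ ε, g ε ^ 2 - ∑ i ∈ U, c i ^ 2) := by linarith
  have := nonneg_of_mul_nonneg_right h4 hA0
  linarith

/-- Twisted sign averages of a polynomial keep the monomials of the matching parity. -/
theorem sum_signs_eval (q : MvPolynomial V ℝ) (δ : V → ℕ) (x : V → ℝ) :
    ∑ ε : V → ℤˣ, (∏ i, ((ε i : ℤ) : ℝ) ^ δ i) * eval (fun i => ((ε i : ℤ) : ℝ) * x i) q =
      2 ^ Fintype.card V * ∑ γ ∈ q.support, coeff γ q *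
        (if ∀ i, Even (δ i + γ i) then ∏ i, x i ^ γ i else 0) := by
  simp_rw [eval_eq', mul_sum]
  rw [sum_comm]
  refine sum_congr rfl fun γ _ => ?_
  have := sum_signs_prod_pow (fun i => δ i + γ i)
  calc _ = (∑ ε : V → ℤˣ, ∏ i, ((ε i : ℤ) : ℝ) ^ (δ i + γ i)) *
        (coeff γ q * ∏ i, x i ^ γ i) := by
        rw [sum_mul]
        refine sum_congr rfl fun ε _ => ?_
        simp_rw [mul_pow, pow_add, prod_mul_distrib]; ring
    _ = _ := by rw [this]; split_ifs <;> simp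

/-- A weighted sum of the coefficients of `q` reduces to the monomials `g k` when the weight `h`
vanishes on all other monomials of `q`. -/
theorem sum_support_eq_of_range {σ ι : Type*} [Fintype ι] (q : MvPolynomial σ ℝ)
    (h : (σ →₀ ℕ) → ℝ) (g : ι → σ →₀ ℕ) (hg : Function.Injective g)
    (hh : ∀ γ ∈ q.support, h γ ≠ 0 → ∃ k, g k = γ) :
    ∑ γ ∈ q.support, coeff γ q * h γ = ∑ k, coeff (g k) q * h (g k) := by
  classical
  rw [← sum_image (s := univ) (g := g) (f := fun γ => coeff γ q * h γ)
    (fun a _ b _ hab => hg hab)]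
  rw [← sum_subset (s₁ := q.support.filter fun γ => h γ ≠ 0) (s₂ := q.support)
      (filter_subset _ _)]
  · refine sum_subset ?_ ?_
    · intro γ hγ
      obtain ⟨h1, h2⟩ := mem_filter.1 hγ
      obtain ⟨k, rfl⟩ := hh γ h1 h2
      exact mem_image_of_mem g (mem_univ k)
    · intro γ _ hγ
      by_cases h1 : γ ∈ q.support
      · have : h γ = 0 := by by_contra h2; exact hγ (mem_filter.2 ⟨h1, h2⟩)
        rw [this, mul_zero]
      · rw [notMem_support_iff.1 h1, zero_mul]
  · intro γ h1 hγ
    have : h γ = 0 := by by_contra h2; exact hγ (mem_filter.2 ⟨h1, h2⟩)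
    rw [this, mul_zero]

theorem sum_signs_eval_quadratic {q : MvPolynomial V ℝ} (hq : q.IsHomogeneous 2) (U : Finset V) :
    ∑ ε : V → ℤˣ, eval (signedIndicator U ε) q =
      2 ^ Fintype.card V * ∑ j ∈ U, coeff (Finsupp.single j 2) q := by
  have h := sum_signs_eval q 0 (fun i => if i ∈ U then 1 else 0)
  simp only [Pi.zero_apply, pow_zero, prod_const_one, one_mul, zero_add] at h
  refine h.trans (congrArg _ ?_)
  rw [sum_support_eq_of_range q _ (fun j : V => Finsupp.single j 2)
    (Finsupp.single_left_injective two_ne_zero)]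
  · rw [← sum_filter_add_sum_filter_not univ (· ∈ U)]
    have e : univ.filter (· ∈ U) = U := by ext; simp
    rw [e, sum_congr rfl (g := fun j => coeff (Finsupp.single j 2) q), add_eq_left]
    · refine sum_eq_zero fun j hj => ?_
      rw [prod_eq_zero (mem_univ j)] <;> simp_all
    · intro j hj
      rw [if_pos, prod_eq_one, mul_one]
      · intro i _
        rcases eq_or_ne i j with rfl | hij
        · simp [hj]
        · simp [hij.symm]
      · intro i
        rw [Finsupp.single_apply]; split_ifs <;> decide
  · intro γ hγ hne
    have hev : ∀ i, Even (γ i) := by by_contra hc; simp [hc] at hne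
    have hdeg : γ.degree = 2 := by
      by_contra hc; exact (mem_support_iff.1 hγ) (hq.coeff_eq_zero hc)
    choose δ hδ using hev
    obtain ⟨β, hβ⟩ : ∃ β : V →₀ ℕ, γ = β + β :=
      ⟨Finsupp.equivFunOnFinite.symm δ, by ext i; simp [hδ]⟩
    have : β.degree = 1 := by rw [hβ, map_add] at hdeg; omega
    obtain ⟨j, rfl⟩ := Finsupp.exists_single_of_degree_eq_one this
    exact ⟨j, by rw [hβ, ← Finsupp.single_add]⟩

theorem sum_signs_eval_cubic {q : MvPolynomial V ℝ} (hq : q.IsHomogeneous 3) {U : Finset V}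
    {i : V} (hi : i ∈ U) :
    ∑ ε : V → ℤˣ, ((ε i : ℤ) : ℝ) * eval (signedIndicator U ε) q =
      2 ^ Fintype.card V * ∑ j ∈ U, coeff (Finsupp.single i 1 + Finsupp.single j 2) q := by
  have h := sum_signs_eval q (fun k => if k = i then 1 else 0) (fun i => if i ∈ U then 1 else 0)
  simp only [pow_ite, pow_one, pow_zero, prod_ite_eq', mem_univ, if_true] at h
  refine h.trans (congrArg _ ?_)
  rw [sum_support_eq_of_range q _ (fun j : V => Finsupp.single i 1 + Finsupp.single j 2)
    (fun a b hab => Finsupp.single_left_injective two_ne_zero (add_left_cancel hab))]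
  · rw [← sum_filter_add_sum_filter_not univ (· ∈ U)]
    have e : univ.filter (· ∈ U) = U := by ext; simp
    rw [e, sum_congr rfl (g := fun j => coeff (Finsupp.single i 1 + Finsupp.single j 2) q),
      add_eq_left]
    · refine sum_eq_zero fun j hj => ?_
      have hj' : j ∉ U := by simpa using hj
      rw [prod_eq_zero (mem_univ j), ite_self, mul_zero]
      simp [hj']
    · intro j hj
      rw [if_pos, prod_eq_one, mul_one]
      · intro k _
        by_cases hk : k ∈ U
        · simp [hk]
        · have h1 : i ≠ k := fun h => hk (h ▸ hi)
          have h2 : j ≠ k := fun h => hk (h ▸ hj)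
          simp [h1, h2]
      · intro k
        rw [Finsupp.add_apply, Finsupp.single_apply, Finsupp.single_apply]
        simp only [eq_comm (a := k)]
        split_ifs <;> decide
  · intro γ hγ hne
    have hev : ∀ k, Even ((if k = i then 1 else 0) + γ k) := by
      by_contra hc; simp [hc] at hne
    have hdeg : γ.degree = 3 := by
      by_contra hc; exact (mem_support_iff.1 hγ) (hq.coeff_eq_zero hc)
    choose δ hδ using hev
    obtain ⟨β, hβ⟩ : ∃ β : V →₀ ℕ, Finsupp.single i 1 + γ = β + β := by
      refine ⟨Finsupp.equivFunOnFinite.symm δ, ?_⟩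
      ext k; simp [← hδ, Finsupp.single_apply, eq_comm]
    have hle : Finsupp.single i 1 ≤ β := by
      rw [Finsupp.single_le_iff]
      have := DFunLike.congr_fun hβ i
      simp at this; omega
    obtain ⟨κ, rfl⟩ := exists_add_of_le hle
    have : κ.degree = 1 := by
      have := congrArg Finsupp.degree hβ
      simp [hdeg] at this; omega
    obtain ⟨j, rfl⟩ := Finsupp.exists_single_of_degree_eq_one this
    refine ⟨j, add_left_cancel (a := Finsupp.single i 1) ?_⟩
    rw [hβ, show (2 : ℕ) = 1 + 1 from rfl, Finsupp.single_add]; abel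

end Signs

/-! ### Necessary conditions for membership in the first two cones -/

theorem eval_homogeneous_two_variables {V : Type*} [Fintype V] [DecidableEq V]
    {q : MvPolynomial V ℝ} {d : ℕ} (hq : q.IsHomogeneous d) {i s : V} (his : i ≠ s) (v : ℝ) :
    eval (fun k => if k = i then 1 else if k = s then v else 0) q =
      ∑ k : Fin (d + 1), coeff (Finsupp.single i (d - k) + Finsupp.single s (k : ℕ)) q *
        v ^ (k : ℕ) := by
  have hval : ∀ γ : V →₀ ℕ, (∀ k, k ≠ i → k ≠ s → γ k = 0) →
      ∏ k, (if k = i then (1 : ℝ) else if k = s then v else 0) ^ γ k = v ^ γ s := by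
    intro γ hγ
    rw [prod_eq_mul i s his]
    · simp [his.symm]
    · intro k _ hk
      rw [hγ k hk.1 hk.2, pow_zero]
    all_goals simp
  rw [eval_eq', sum_support_eq_of_range q _
    (fun k : Fin (d + 1) => Finsupp.single i (d - k) + Finsupp.single s (k : ℕ))]
  · refine sum_congr rfl fun k _ => ?_
    rw [hval]
    · simp [his]
    · intro j hj hj'
      simp [hj, hj']
  · intro k l hkl
    have := DFunLike.congr_fun hkl s
    simpa [his, Fin.ext_iff] using this
  · intro γ hγ hne
    have hz : ∀ k, k ≠ i → k ≠ s → γ k = 0 := by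
      intro k hk hk'
      by_contra h0
      refine hne (prod_eq_zero (mem_univ k) ?_)
      simp [hk, hk', h0]
    have hdeg : γ.degree = d := by
      by_contra hc; exact (mem_support_iff.1 hγ) (hq.coeff_eq_zero hc)
    have hγe : γ = Finsupp.single i (γ i) + Finsupp.single s (γ s) := by
      ext k
      rcases eq_or_ne k i with rfl | hk
      · simp [his]
      · rcases eq_or_ne k s with rfl | hk'
        · simp [hk]
        · simp [hk, hk', hz k hk hk']
    have hsum : γ i + γ s = d := by
      rw [← hdeg]; conv_rhs => rw [hγe]
      simp
    refine ⟨⟨γ s, by omega⟩, ?_⟩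
    refine Eq.trans ?_ hγe.symm
    congr 2
    exact (Nat.sub_eq_of_eq_add hsum.symm)

section Necessary

variable {V : Type*} [Fintype V] [DecidableEq V]

theorem sum_sum_indicator (M : Matrix V V ℝ) (U : Finset V) {x : V → ℝ}
    (hx : ∀ i, x i ^ 2 = if i ∈ U then 1 else 0) :
    ∑ i, ∑ j, M i j * x i ^ 2 * x j ^ 2 = ∑ i ∈ U, ∑ j ∈ U, M i j := by
  simp [hx, sum_ite_mem]

theorem sum_sum_two_variables (M : Matrix V V ℝ) {i s : V} (his : i ≠ s) (v : ℝ) :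
    ∑ k, ∑ l, M k l * (if k = i then 1 else if k = s then v else 0) ^ 2 *
      (if l = i then 1 else if l = s then v else 0) ^ 2 =
      M i i + (M i s + M s i) * v ^ 2 + M s s * v ^ 4 := by
  have h : ∀ f : V → ℝ, ∑ k, f k * (if k = i then 1 else if k = s then v else 0) ^ 2 =
      f i + f s * v ^ 2 := by
    intro f
    rw [Fintype.sum_eq_add i s his]
    · simp [his.symm]
    · intro k hk; simp [hk.1, hk.2]
  calc _ = ∑ k, (∑ l, M k l * (if l = i then 1 else if l = s then v else 0) ^ 2) *
        (if k = i then 1 else if k = s then v else 0) ^ 2 := by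
        refine sum_congr rfl fun k _ => ?_
        rw [sum_mul]; exact sum_congr rfl fun l _ => by ring
    _ = _ := by simp_rw [h]; ring

/-- Membership in the cone of level `0` provides linear forms `L r`, the even parts of the squared
polynomials, whose squares are dominated by the form of `M`, with equality on the diagonal. -/
theorem exists_linear_of_mem_parriloCone_zero {M : Matrix V V ℝ} (h : M ∈ parriloCone V 0) :
    ∃ (n : ℕ) (L : Fin n → V → ℝ),
      (∀ U : Finset V, ∑ r, (∑ j ∈ U, L r j) ^ 2 ≤ ∑ i ∈ U, ∑ j ∈ U, M i j) ∧
      ∀ i s, i ≠ s → ∑ r, L r i ^ 2 = M i i := by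
  obtain ⟨n, q, hq, he⟩ := exists_eval_of_mem_parriloCone h
  simp only [pow_zero, one_mul, zero_add] at hq he
  refine ⟨n, fun r j => coeff (Finsupp.single j 2) (q r), fun U => ?_, fun i s his => ?_⟩
  · set A : ℝ := 2 ^ Fintype.card V with hA
    have hA0 : 0 < A := by positivity
    have hcard : ((univ : Finset (V → ℤˣ)).card : ℝ) = A := by
      simp [hA]
    have h1 : ∀ r, A * (∑ j ∈ U, coeff (Finsupp.single j 2) (q r)) ^ 2 ≤
        ∑ ε : V → ℤˣ, eval (signedIndicator U ε) (q r) ^ 2 := by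
      intro r
      have h2 := sq_sum_le_card_mul_sum_sq (s := (univ : Finset (V → ℤˣ)))
        (f := fun ε => eval (signedIndicator U ε) (q r))
      rw [sum_signs_eval_quadratic (hq r), hcard, ← hA, mul_pow, sq A, mul_assoc] at h2
      exact le_of_mul_le_mul_left h2 hA0
    have h3 := sum_le_sum fun r (_ : r ∈ univ) => h1 r
    rw [← mul_sum, sum_comm] at h3
    rw [sum_congr rfl fun ε _ => (he (signedIndicator U ε)).symm.trans
      (sum_sum_indicator M U (signedIndicator_sq U ε)), sum_const, nsmul_eq_mul, hcard] at h3
    exact le_of_mul_le_mul_left h3 hA0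
  · have h1 := he (fun k => if k = i then 1 else if k = s then 0 else 0)
    rw [sum_sum_two_variables M his] at h1
    have h2 : ∀ r, eval (fun k => if k = i then 1 else if k = s then 0 else 0) (q r) =
        coeff (Finsupp.single i 2) (q r) := fun r => by
      rw [eval_homogeneous_two_variables (hq r) his 0, Fin.sum_univ_three]
      simp
    simp only [h2] at h1
    simpa using h1.symm

/-- Membership in the cone of level `1` provides linear forms `l r i`, obtained from the part of
the `r`-th cubic that is odd in the variable `i` only. -/
theorem exists_linear_of_mem_parriloCone_one {M : Matrix V V ℝ} (h : M ∈ parriloCone V 1) :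
    ∃ (n : ℕ) (l : Fin n → V → V → ℝ),
      (∀ U : Finset V, ∑ i ∈ U, ∑ r, (∑ j ∈ U, l r i j) ^ 2 ≤
        #U * ∑ i ∈ U, ∑ j ∈ U, M i j) ∧
      ∀ i s, i ≠ s → ∑ r, (2 * (l r i i * l r i s) + l r s i ^ 2) = 2 * M i s + M i i := by
  have hsymm := h.1
  obtain ⟨n, q, hq, he⟩ := exists_eval_of_mem_parriloCone h
  simp only [pow_one] at he
  refine ⟨n, fun r i j => coeff (Finsupp.single i 1 + Finsupp.single j 2) (q r), fun U => ?_,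
    fun i s his => ?_⟩
  · set A : ℝ := 2 ^ Fintype.card V with hA
    have hA0 : 0 < A := by positivity
    have hcard : ((univ : Finset (V → ℤˣ)).card : ℝ) = A := by
      simp [hA]
    have h1 : ∀ r, A * ∑ i ∈ U,
        (∑ j ∈ U, coeff (Finsupp.single i 1 + Finsupp.single j 2) (q r)) ^ 2 ≤
        ∑ ε : V → ℤˣ, eval (signedIndicator U ε) (q r) ^ 2 := by
      intro r
      have h2 := sum_sq_sum_signs_le U (fun ε => eval (signedIndicator U ε) (q r))
      rw [sum_congr rfl fun i hi => by rw [sum_signs_eval_cubic (hq r) hi, mul_pow], ← hA,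
        ← mul_sum, sq A, mul_assoc] at h2
      exact le_of_mul_le_mul_left h2 hA0
    have h3 := sum_le_sum fun r (_ : r ∈ univ) => h1 r
    have hval : ∀ ε, ∑ r, eval (signedIndicator U ε) (q r) ^ 2 =
        #U * ∑ i ∈ U, ∑ j ∈ U, M i j := fun ε => by
      rw [← he, sum_sum_indicator M U (signedIndicator_sq U ε)]
      simp [signedIndicator_sq]
    rw [← mul_sum, sum_comm, sum_comm (s := univ) (t := univ),
      sum_congr rfl fun ε _ => hval ε, sum_const, nsmul_eq_mul, hcard] at h3
    exact le_of_mul_le_mul_left h3 hA0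
  · have hv : ∀ v : ℝ, (1 + v ^ 2) * (M i i + (M i s + M s i) * v ^ 2 + M s s * v ^ 4) =
        ∑ r, (coeff (Finsupp.single i 1 + Finsupp.single i 2) (q r) +
          coeff (Finsupp.single s 1 + Finsupp.single i 2) (q r) * v +
          coeff (Finsupp.single i 1 + Finsupp.single s 2) (q r) * v ^ 2 +
          coeff (Finsupp.single s 1 + Finsupp.single s 2) (q r) * v ^ 3) ^ 2 := by
      intro v
      have h1 := he (fun k => if k = i then 1 else if k = s then v else 0)
      rw [sum_sum_two_variables M his] at h1
      have h2 : ∑ k, (if k = i then (1 : ℝ) else if k = s then v else 0) ^ 2 = 1 + v ^ 2 := by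
        rw [Fintype.sum_eq_add i s his]
        · simp [his.symm]
        · intro k hk; simp [hk.1, hk.2]
      rw [h2] at h1
      rw [h1]
      refine sum_congr rfl fun r _ => ?_
      have e1 : Finsupp.single i 1 + Finsupp.single i 2 = Finsupp.single i 3 := by
        rw [← Finsupp.single_add]
      have e2 : Finsupp.single s 1 + Finsupp.single s 2 = Finsupp.single s 3 := by
        rw [← Finsupp.single_add]
      rw [eval_homogeneous_two_variables (d := 3) (hq r) his v, Fin.sum_univ_four,
        e1, e2, add_comm (Finsupp.single s 1)]
      simp
    rw [hsymm.apply i s] at hv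
    simp only
    generalize hA : (fun r => coeff (Finsupp.single i 1 + Finsupp.single i 2) (q r)) = A at *
    generalize hB : (fun r => coeff (Finsupp.single s 1 + Finsupp.single i 2) (q r)) = B at *
    generalize hC : (fun r => coeff (Finsupp.single i 1 + Finsupp.single s 2) (q r)) = C at *
    generalize hD : (fun r => coeff (Finsupp.single s 1 + Finsupp.single s 2) (q r)) = D at *
    have hv' : ∀ v : ℝ, (1 + v ^ 2) * (M i i + (M i s + M i s) * v ^ 2 + M s s * v ^ 4) =
        ∑ r, A r ^ 2 + (∑ r, 2 * A r * B r) * v + (∑ r, (2 * (A r * C r) + B r ^ 2)) * v ^ 2 +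
        (∑ r, (2 * A r * D r + 2 * B r * C r)) * v ^ 3 + (∑ r, (2 * B r * D r + C r ^ 2)) * v ^ 4 +
        (∑ r, 2 * C r * D r) * v ^ 5 + (∑ r, D r ^ 2) * v ^ 6 := by
      intro v
      rw [hv v]
      simp only [sum_mul, ← sum_add_distrib]
      refine sum_congr rfl fun r _ => ?_
      rw [← congrFun hA r, ← congrFun hB r, ← congrFun hC r, ← congrFun hD r]
      ring
    have goal : ∑ r, (2 * (A r * C r) + B r ^ 2) = 2 * M i s + M i i := by
      -- Seven values determine the coefficients of a polynomial of degree six.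
      have v0 := hv' 0
      have v1 := hv' 1
      have v2 := hv' (-1)
      have v3 := hv' 2
      have v4 := hv' (-2)
      have v5 := hv' 3
      have v6 := hv' (-3)
      norm_num at v0 v1 v2 v3 v4 v5 v6
      linarith
    rw [← goal]
    refine sum_congr rfl fun r _ => ?_
    rw [← congrFun hA r, ← congrFun hB r, ← congrFun hC r]

end Necessary

/-! ### The theta rank -/

open Classical in
theorem thetaMatrix_apply {V : Type*} [Fintype V] (G : SimpleGraph V) (t : ℝ) (i j : V) :
    thetaMatrix G t i j = (if i = j ∨ G.Adj i j then t else 0) - 1 := by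
  simp only [thetaMatrix, Matrix.sub_apply, Matrix.smul_apply, Matrix.add_apply,
    SimpleGraph.adjMatrix_apply, Matrix.one_apply, Matrix.of_apply, smul_eq_mul]
  by_cases h : i = j
  · subst h; simp
  · simp [h]

theorem thetaMatrix_isSymm {V : Type*} [Fintype V] (G : SimpleGraph V) (t : ℝ) :
    (thetaMatrix G t).IsSymm := by
  ext i j
  classical
  rw [Matrix.transpose_apply, thetaMatrix_apply, thetaMatrix_apply]
  exact congrArg (· - 1) (if_congr (or_congr eq_comm (G.adj_comm j i)) rfl rfl)

theorem sum_thetaMatrix_of_isIndepSet {V : Type*} [Fintype V] {G : SimpleGraph V} (t : ℝ)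
    {U : Finset V} (hU : G.IsIndepSet U) :
    ∑ i ∈ U, ∑ j ∈ U, thetaMatrix G t i j = #U * t - (#U : ℝ) ^ 2 := by
  classical
  have : ∀ i ∈ U, ∑ j ∈ U, thetaMatrix G t i j = t - #U := by
    intro i hi
    have h : ∀ j ∈ U, thetaMatrix G t i j = (if i = j then t else 0) - 1 := by
      intro j hj
      rw [thetaMatrix_apply]
      by_cases hij : i = j
      · simp [hij]
      · simp [hij, hU hi hj hij]
    rw [sum_congr rfl h]
    simp [hi]
  rw [sum_congr rfl this]
  simp; ring

/-- Every feasible value is at least the stability number, so the minimum is the stability number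
exactly when the stability number is feasible. -/
theorem isTheta_indepNum_iff {V : Type*} [Fintype V] (G : SimpleGraph V) (r : ℕ)
    (hpos : 0 < G.indepNum) :
    IsTheta G r G.indepNum ↔ thetaMatrix G G.indepNum ∈ parriloCone V r := by
  classical
  refine ⟨fun h => h.1, fun h => ⟨h, fun s hs => ?_⟩⟩
  obtain ⟨S, hS⟩ := G.exists_isNIndepSet_indepNum
  obtain ⟨n, q, -, he⟩ := exists_eval_of_mem_parriloCone hs
  have h1 := he (fun i => if i ∈ S then 1 else 0)
  have hsq : ∀ i, (if i ∈ S then (1 : ℝ) else 0) ^ 2 = if i ∈ S then 1 else 0 := by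
    intro i; split_ifs <;> simp
  rw [sum_sum_indicator _ S hsq, sum_thetaMatrix_of_isIndepSet s hS.1] at h1
  have h2 : ∑ i, (if i ∈ S then (1 : ℝ) else 0) ^ 2 = #S := by simp
  rw [h2, hS.2] at h1
  have hp : (0 : ℝ) < G.indepNum := by exact_mod_cast hpos
  have h3 : 0 ≤ (G.indepNum : ℝ) ^ r * (G.indepNum * s - (G.indepNum : ℝ) ^ 2) := by
    rw [h1]; exact sum_nonneg fun _ _ => sq_nonneg _
  have h4 := nonneg_of_mul_nonneg_right h3 (pow_pos hp r)
  have h5 : 0 ≤ (G.indepNum : ℝ) * (s - G.indepNum) := by linarith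
  have := nonneg_of_mul_nonneg_right h5 hp
  linarith

theorem thetaRank_le_iff {V : Type*} [Fintype V] (G : SimpleGraph V) (k : ℕ) :
    thetaRank G ≤ k ↔ ∃ r ≤ k, IsTheta G r G.indepNum := by
  constructor
  · intro h
    by_contra! hc
    have : ((k + 1 : ℕ) : ℕ∞) ≤ thetaRank G := by
      refine le_iInf₂ fun r hr => ?_
      have : k < r := by
        by_contra hle; exact hc r (not_lt.1 hle) hr
      exact_mod_cast this
    have := this.trans h
    norm_cast at this
    omega
  · rintro ⟨r, hr, h⟩
    exact (iInf₂_le r h).trans (by exact_mod_cast hr)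

theorem thetaRank_eq_one_iff {V : Type*} [Fintype V] (G : SimpleGraph V)
    (h0 : ¬ IsTheta G 0 G.indepNum) : thetaRank G = 1 ↔ IsTheta G 1 G.indepNum := by
  have hz : ¬ thetaRank G ≤ (0 : ℕ) := by
    rw [thetaRank_le_iff]
    rintro ⟨r, hr, h⟩
    obtain rfl : r = 0 := by omega
    exact h0 h
  have h1 : thetaRank G ≤ (1 : ℕ) ↔ IsTheta G 1 G.indepNum := by
    rw [thetaRank_le_iff]
    constructor
    · rintro ⟨r, hr, h⟩
      interval_cases r
      · exact absurd h h0
      · exact h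
    · exact fun h => ⟨1, le_rfl, h⟩
  rw [← h1]
  have h2 : 1 ≤ thetaRank G := by
    rw [Order.one_le_iff_ne_zero]
    rintro h; exact hz (by simp [h])
  exact ⟨fun h => by simp [h], fun h => le_antisymm (by exact_mod_cast h) h2⟩

theorem IsSumSq.map_ringHom {R S F : Type*} [CommSemiring R] [CommSemiring S] [FunLike F R S]
    [RingHomClass F R S] (f : F) {p : R} (h : IsSumSq p) : IsSumSq (f p) := by
  obtain ⟨n, q, rfl⟩ := h.exists_fin
  simp only [map_sum, map_pow]
  exact IsSumSq.sum_sq _ _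

theorem mem_parriloCone_of_iso {V W : Type*} [Fintype V] [Fintype W] {G : SimpleGraph V}
    {H : SimpleGraph W} (e : G ≃g H) {r : ℕ} {t : ℝ} (h : thetaMatrix G t ∈ parriloCone V r) :
    thetaMatrix H t ∈ parriloCone W r := by
  classical
  refine ⟨thetaMatrix_isSymm H t, ?_⟩
  have h1 := h.2.map_ringHom (rename (R := ℝ) e)
  have hM : ∀ i j, thetaMatrix G t i j = thetaMatrix H t (e i) (e j) := fun i j => by
    simp [thetaMatrix_apply, e.map_adj_iff]
  have hsq : rename e (squaredForm (thetaMatrix G t)) = squaredForm (thetaMatrix H t) := by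
    simp only [squaredForm, map_sum, map_mul, map_pow, rename_C, rename_X, hM]
    rw [← Equiv.sum_comp e.toEquiv]
    refine sum_congr rfl fun i _ => ?_
    rw [← Equiv.sum_comp e.toEquiv]
    rfl
  have hX : rename e (∑ i : V, (X i : MvPolynomial V ℝ) ^ 2) =
      ∑ i : W, (X i : MvPolynomial W ℝ) ^ 2 := by
    simp only [map_sum, map_pow, rename_X]
    exact Equiv.sum_comp e.toEquiv fun i => (X i : MvPolynomial W ℝ) ^ 2
  rwa [map_mul, map_pow, hX, hsq] at h1

theorem indepNum_le_of_iso {V W : Type*} [Fintype V] [Fintype W] {G : SimpleGraph V}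
    {H : SimpleGraph W} (e : G ≃g H) : G.indepNum ≤ H.indepNum := by
  classical
  obtain ⟨S, hS⟩ := G.exists_isNIndepSet_indepNum
  rw [← hS.2, ← card_map e.toEquiv.toEmbedding]
  refine SimpleGraph.IsIndepSet.card_le_indepNum ?_
  intro a ha b hb hab
  simp only [coe_map, Set.mem_image] at ha hb
  obtain ⟨x, hx, rfl⟩ := ha
  obtain ⟨y, hy, rfl⟩ := hb
  exact fun h => hS.1 hx hy (fun h' => hab (by rw [h'])) (e.map_adj_iff.1 h)

theorem thetaRank_eq_of_iso {V W : Type*} [Fintype V] [Fintype W] {G : SimpleGraph V}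
    {H : SimpleGraph W} (e : G ≃g H) : thetaRank G = thetaRank H := by
  have hα : G.indepNum = H.indepNum :=
    le_antisymm (indepNum_le_of_iso e) (indepNum_le_of_iso e.symm)
  have hset : ∀ r s, thetaMatrix G s ∈ parriloCone V r ↔ thetaMatrix H s ∈ parriloCone W r :=
    fun r s => ⟨mem_parriloCone_of_iso e, mem_parriloCone_of_iso e.symm⟩
  simp only [thetaRank, IsTheta, hset, hα]

/-! ### Graphs with isolated nodes: necessity -/

/-- Weightings of the vertices that give the same total to all stable sets of size `a` are
constant. This holds when the critical edges connect the graph. -/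
def SimpleGraph.IsStableRigid {V : Type*} (G : SimpleGraph V) (a : ℕ) : Prop :=
  ∀ (L : V → ℝ) (c : ℝ), (∀ S : Finset V, G.IsIndepSet S → #S = a → ∑ i ∈ S, L i = c) →
    ∀ i j, L i = L j

theorem isIndepSet_disjSum {V W : Type*} {G : SimpleGraph V} {S : Finset V}
    (hS : G.IsIndepSet S) (T : Finset W) :
    (G ⊕g (⊥ : SimpleGraph W)).IsIndepSet (S.disjSum T : Finset (V ⊕ W)) := by
  intro x hx y hy hxy
  rw [mem_coe, mem_disjSum] at hx hy
  rcases hx with ⟨i, hi, rfl⟩ | ⟨s, -, rfl⟩ <;> rcases hy with ⟨j, hj, rfl⟩ | ⟨t, -, rfl⟩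
  · simpa using hS hi hj (fun h => hxy (by rw [h]))
  all_goals simp

section Isolated

variable {V : Type*} [Fintype V] {G : SimpleGraph V} {a m : ℕ}

/-- Rigidity makes the linear forms of a level-zero certificate constant on `V`, with sum of
squares `α - 1`, so at a pair of nonadjacent vertices their squares add up to `4 * (α - 1)`, which
exceeds the value `2 * α - 4` of the form of the matrix. -/
theorem not_mem_parriloCone_zero (ha : 2 ≤ a) (hrigid : G.IsStableRigid a) {S₀ : Finset V}
    (hS₀ : G.IsIndepSet S₀) (hcard : #S₀ = a) :
    thetaMatrix (G ⊕g (⊥ : SimpleGraph (Fin m))) (a + m) ∉ parriloCone (V ⊕ Fin m) 0 := by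
  classical
  intro h
  obtain ⟨n, L, hle, hdiag⟩ := exists_linear_of_mem_parriloCone_zero h
  have hzero : ∀ S : Finset V, G.IsIndepSet S → #S = a → ∀ r,
      ∑ i ∈ S, L r (.inl i) = -∑ s, L r (.inr s) := by
    intro S hS hSa r
    have h1 := hle (S.disjSum univ)
    rw [sum_thetaMatrix_of_isIndepSet _ (isIndepSet_disjSum hS univ), card_disjSum, hSa,
      card_univ, Fintype.card_fin] at h1
    have h2 : ∑ r, (∑ j ∈ S.disjSum univ, L r j) ^ 2 = 0 := by
      refine le_antisymm (h1.trans_eq ?_) (sum_nonneg fun _ _ => sq_nonneg _)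
      push_cast; ring
    have h3 := (sum_eq_zero_iff_of_nonneg fun r _ => sq_nonneg _).1 h2 r (mem_univ r)
    rw [sq_eq_zero_iff, sum_disjSum] at h3
    linarith
  have hconst : ∀ r i j, L r (.inl i) = L r (.inl j) := fun r =>
    hrigid (fun i => L r (.inl i)) _ fun S hS hSa => hzero S hS hSa r
  obtain ⟨i, hi, j, hj, hij⟩ := one_lt_card.1 (by omega : 1 < #S₀)
  have hpair : (G ⊕g (⊥ : SimpleGraph (Fin m))).IsIndepSet
      (({i, j} : Finset V).disjSum (∅ : Finset (Fin m)) : Finset (V ⊕ Fin m)) := by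
    refine isIndepSet_disjSum ?_ _
    refine hS₀.mono ?_
    intro x hx
    simp only [coe_insert, coe_singleton, Set.mem_insert_iff, Set.mem_singleton_iff] at hx
    rcases hx with rfl | rfl <;> assumption
  have h1 := hle (({i, j} : Finset V).disjSum (∅ : Finset (Fin m)))
  rw [sum_thetaMatrix_of_isIndepSet _ hpair] at h1
  simp only [sum_disjSum, sum_pair hij, sum_empty, add_zero, card_disjSum, card_pair hij,
    card_empty, hconst _ j i] at h1
  have h2 := hdiag (.inl i) (.inl j) (by simpa using hij)
  rw [thetaMatrix_apply, if_pos (Or.inl rfl)] at h2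
  have h3 : ∑ r, (L r (.inl i) + L r (.inl i)) ^ 2 = 4 * ∑ r, L r (.inl i) ^ 2 := by
    rw [mul_sum]; exact sum_congr rfl fun r _ => by ring
  rw [h3, h2] at h1
  have ha' : (2 : ℝ) ≤ a := by exact_mod_cast ha
  push_cast at h1
  nlinarith [(Nat.cast_nonneg m : (0 : ℝ) ≤ m)]

/-- The level-one cone forces `m * (a - 1) ≤ 4 * a`. The argument applies the Cauchy–Schwarz
inequality to the linear forms at a vertex `i` of a maximum stable set `S₀` of `G`, evaluated at
`i` and at the set of isolated nodes; rigidity gives the value of the forms at an isolated node. -/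
theorem mul_le_of_mem_parriloCone_one {b : ℕ} (hb : 1 ≤ b) (hrigid : G.IsStableRigid (b + 1))
    {S₀ : Finset V} (hS₀ : G.IsIndepSet S₀) (hcard : #S₀ = b + 1)
    (h : thetaMatrix (G ⊕g (⊥ : SimpleGraph (Fin m))) ((b + 1 : ℕ) + m) ∈
      parriloCone (V ⊕ Fin m) 1) : m * b ≤ 4 * (b + 1) := by
  classical
  by_contra! hlt
  set a : ℝ := ((b + 1 : ℕ) : ℝ) with ha
  obtain ⟨n, l, hle, hpair⟩ := exists_linear_of_mem_parriloCone_one h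
  have hstable : ∀ (S : Finset V) (T : Finset (Fin m)), G.IsIndepSet S →
      ∑ x ∈ S.disjSum T, ∑ r, (∑ j ∈ S, l r x (.inl j) + ∑ s ∈ T, l r x (.inr s)) ^ 2 ≤
        (#S + #T : ℝ) * ((#S + #T : ℝ) * (a + m) - (#S + #T : ℝ) ^ 2) := by
    intro S T hS
    have h1 := hle (S.disjSum T)
    rw [sum_thetaMatrix_of_isIndepSet _ (isIndepSet_disjSum hS T), card_disjSum] at h1
    simpa only [sum_disjSum, Nat.cast_add] using h1
  have hzero : ∀ S : Finset V, G.IsIndepSet S → #S = b + 1 → ∀ x ∈ S.disjSum univ, ∀ r,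
      ∑ j ∈ S, l r x (.inl j) = -∑ s, l r x (.inr s) := by
    intro S hS hSa x hx r
    have h1 := hstable S univ hS
    have h2 : ∑ x ∈ S.disjSum univ, ∑ r, (∑ j ∈ S, l r x (.inl j) + ∑ s, l r x (.inr s)) ^ 2
        = 0 := by
      refine le_antisymm (h1.trans_eq ?_)
        (sum_nonneg fun _ _ => sum_nonneg fun _ _ => sq_nonneg _)
      rw [hSa, ← ha, card_univ, Fintype.card_fin]; ring
    have h3 := (sum_eq_zero_iff_of_nonneg
      fun x _ => sum_nonneg fun _ _ => sq_nonneg _).1 h2 x hx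
    have h4 := (sum_eq_zero_iff_of_nonneg fun r _ => sq_nonneg _).1 h3 r (mem_univ r)
    rw [sq_eq_zero_iff] at h4
    linarith
  -- The form at an isolated node takes one value on all vertices of `G`.
  have hconst : ∀ s r i j, l r (.inr s) (.inl i) = l r (.inr s) (.inl j) := fun s r =>
    hrigid (fun i => l r (.inr s) (.inl i)) _ fun S hS hSa =>
      hzero S hS hSa (.inr s) (by simp) r
  -- Values of the form of `M` at the indicators of `{i}`, of `S₀` and of the set of isolated nodes
  -- bound the three sums of squares.
  have hX : ∑ i ∈ S₀, ∑ r, l r (.inl i) (.inl i) ^ 2 ≤ a * (a + m - 1) := by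
    have h1 : ∀ i ∈ S₀, ∑ r, l r (.inl i) (.inl i) ^ 2 ≤ a + m - 1 := by
      intro i _
      have h2 := hstable {i} ∅ (by simp)
      simp only [sum_disjSum, sum_singleton, sum_empty, card_singleton, card_empty, add_zero,
        Nat.cast_one, Nat.cast_zero] at h2
      linarith
    refine (sum_le_sum h1).trans_eq ?_
    rw [sum_const, hcard, nsmul_eq_mul]
  have hY : ∑ i ∈ S₀, ∑ r, (∑ s, l r (.inl i) (.inr s)) ^ 2 ≤ a ^ 2 * m := by
    have h1 := hstable S₀ ∅ hS₀
    simp only [sum_disjSum, sum_empty, card_empty, add_zero, Nat.cast_zero, hcard, ← ha] at h1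
    refine le_trans (le_of_eq ?_) (h1.trans_eq (by ring))
    refine sum_congr rfl fun i hi => sum_congr rfl fun r _ => ?_
    rw [hzero S₀ hS₀ hcard (.inl i) (by simpa using hi) r, neg_sq]
  have hA : ∑ s, ∑ i ∈ S₀, ∑ r, l r (.inr s) (.inl i) ^ 2 ≤ (m : ℝ) ^ 2 := by
    have h1 := hstable ∅ univ (by simp)
    simp only [sum_disjSum, sum_empty, card_empty, zero_add, Nat.cast_zero, card_univ,
      Fintype.card_fin] at h1
    have ha0 : 0 < a := by rw [ha]; positivity
    have h2 : ∀ s r, a * ∑ i ∈ S₀, l r (.inr s) (.inl i) ^ 2 =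
        (∑ t, l r (.inr s) (.inr t)) ^ 2 := by
      intro s r
      rw [← neg_sq, ← hzero S₀ hS₀ hcard (.inr s) (by simp) r]
      obtain ⟨i, hi⟩ := card_pos.1 (by omega : 0 < #S₀)
      simp only [hconst s r _ i, sum_const, hcard, nsmul_eq_mul, ← ha]
      ring
    have h3 : a * ∑ s, ∑ i ∈ S₀, ∑ r, l r (.inr s) (.inl i) ^ 2 =
        ∑ s, ∑ r, (∑ t, l r (.inr s) (.inr t)) ^ 2 := by
      rw [mul_sum]
      refine sum_congr rfl fun s _ => ?_
      rw [sum_comm, mul_sum]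
      exact sum_congr rfl fun r _ => h2 s r
    rw [← h3] at h1
    have h4 : a * ∑ s, ∑ i ∈ S₀, ∑ r, l r (.inr s) (.inl i) ^ 2 ≤ a * (m : ℝ) ^ 2 :=
      h1.trans_eq (by ring)
    exact le_of_mul_le_mul_left h4 ha0
  -- Comparing coefficients of `x i ^ 4 * x s ^ 2` bounds the inner products from below.
  set Z := ∑ i ∈ S₀, ∑ r, l r (.inl i) (.inl i) * ∑ s, l r (.inl i) (.inr s) with hZ
  have hZlow : a * m * (a + m - 3) - (m : ℝ) ^ 2 ≤ 2 * Z := by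
    have h1 : ∑ i ∈ S₀, ∑ s : Fin m, ∑ r, (2 * (l r (.inl i) (.inl i) * l r (.inl i) (.inr s)) +
        l r (.inr s) (.inl i) ^ 2) = a * m * (a + m - 3) := by
      rw [sum_congr rfl fun i _ => sum_congr rfl fun s _ => hpair (.inl i) (.inr s) (by simp)]
      simp [thetaMatrix_apply, hcard, ← ha]
      rw [ha]; push_cast; ring
    have h2 : ∑ i ∈ S₀, ∑ s : Fin m, ∑ r,
        (2 * (l r (.inl i) (.inl i) * l r (.inl i) (.inr s)) + l r (.inr s) (.inl i) ^ 2) =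
        2 * Z + ∑ s, ∑ i ∈ S₀, ∑ r, l r (.inr s) (.inl i) ^ 2 := by
      simp only [sum_add_distrib, ← mul_sum]
      rw [sum_comm (s := univ) (t := S₀)]
      congr 2
      refine sum_congr rfl fun i _ => ?_
      rw [sum_comm]
      simp only [mul_sum]
    linarith
  have hCS : Z ^ 2 ≤ (∑ i ∈ S₀, ∑ r, l r (.inl i) (.inl i) ^ 2) *
      ∑ i ∈ S₀, ∑ r, (∑ s, l r (.inl i) (.inr s)) ^ 2 := by
    simp only [hZ, ← sum_product']
    exact sum_mul_sq_le_sq_mul_sq _ _ _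
  have hb' : (1 : ℝ) ≤ b := by exact_mod_cast hb
  have hab : a = b + 1 := by rw [ha]; push_cast; ring
  have hlt' : 4 * a < m * b := by rw [ha]; exact_mod_cast hlt
  have hm : (0 : ℝ) < m := by
    by_contra hc
    nlinarith
  have hlow0 : 0 ≤ a * m * (a + m - 3) - (m : ℝ) ^ 2 := by
    have : 0 ≤ m * (a * (a + m - 3) - m) := by
      refine mul_nonneg hm.le ?_
      nlinarith [sq_nonneg ((b : ℝ) - 1)]
    linarith
  have hYX : Z ^ 2 ≤ (a * (a + m - 1)) * (a ^ 2 * m) :=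
    hCS.trans (mul_le_mul hX hY (sum_nonneg fun _ _ => sum_nonneg fun _ _ => sq_nonneg _)
      (by nlinarith))
  have hsq : (a * m * (a + m - 3) - (m : ℝ) ^ 2) ^ 2 ≤ (2 * Z) ^ 2 :=
    pow_le_pow_left₀ hlow0 hZlow 2
  have hid : (a * m * (a + m - 3) - (m : ℝ) ^ 2) ^ 2 - 4 * ((a * (a + m - 1)) * (a ^ 2 * m)) =
      m * (b * (m * b - 4 * a) * (m + a) ^ 2) := by rw [hab]; ring
  have hpos : 0 < m * (b * (m * b - 4 * a) * (m + a) ^ 2) := by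
    have : 0 < m * b - 4 * a := by linarith
    have : (0 : ℝ) < m + a := by linarith
    positivity
  nlinarith

end Isolated

/-! ### Certificates for the cone of level one -/

section Certificates

variable {V : Type*} [Fintype V]

theorem squaredForm_add (M N : Matrix V V ℝ) :
    squaredForm (M + N) = squaredForm M + squaredForm N := by
  simp [squaredForm, add_mul, sum_add_distrib]

theorem squaredForm_smul (c : ℝ) (M : Matrix V V ℝ) :
    squaredForm (c • M) = C c * squaredForm M := by
  simp [squaredForm, mul_sum, mul_assoc]

theorem squaredForm_sum {ι : Type*} (s : Finset ι) (M : ι → Matrix V V ℝ) :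
    squaredForm (∑ k ∈ s, M k) = ∑ k ∈ s, squaredForm (M k) := by
  classical
  induction s using Finset.induction_on with
  | empty => simp [squaredForm]
  | insert a s ha ih => rw [sum_insert ha, sum_insert ha, squaredForm_add, ih]

theorem isSumSq_C {σ : Type*} {c : ℝ} (hc : 0 ≤ c) : IsSumSq (C c : MvPolynomial σ ℝ) := by
  rw [← Real.mul_self_sqrt hc, C_mul]
  exact IsSumSq.mul_self _

theorem isSumSq_squaredForm_vecMulVec (v : V → ℝ) :
    IsSumSq (squaredForm (Matrix.vecMulVec v v)) := by
  have : squaredForm (Matrix.vecMulVec v v) =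
      (∑ i, C (v i) * X i ^ 2) * ∑ i, C (v i) * X i ^ 2 := by
    rw [sum_mul_sum]
    refine sum_congr rfl fun i _ => sum_congr rfl fun j _ => ?_
    rw [Matrix.vecMulVec_apply, C_mul]; ring
  rw [this]
  exact IsSumSq.mul_self _

theorem isSumSq_squaredForm_smul_sum {ι : Type*} [Fintype ι] {c : ℝ} (hc : 0 ≤ c)
    (v : ι → V → ℝ) :
    IsSumSq (squaredForm (c • ∑ k, Matrix.vecMulVec (v k) (v k))) := by
  rw [squaredForm_smul, squaredForm_sum]
  exact (isSumSq_C hc).mul (IsSumSq.sum fun k _ => isSumSq_squaredForm_vecMulVec _)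

/-- Parrilo's sufficient condition for level one: with `y = x ^ 2`, the product of `∑ i, y i` and
the form of `M` is `∑ i, y i * (yᵀ (P i) y)` plus a form in `y` with nonnegative coefficients. -/
theorem mem_parriloCone_one_of_certificate {M : Matrix V V ℝ} (hM : M.IsSymm)
    (P : V → Matrix V V ℝ) (hP : ∀ i, IsSumSq (squaredForm (P i)))
    (hle : ∀ i j k, P i j k + P j i k + P k i j ≤ M i j + M j k + M i k) :
    M ∈ parriloCone V 1 := by
  refine ⟨hM, ?_⟩
  set T : (V → V → V → ℝ) → MvPolynomial V ℝ := fun f =>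
    ∑ i, ∑ j, ∑ k, C (f i j k) * (X i ^ 2 * X j ^ 2 * X k ^ 2) with hT
  have T1 : ∀ f, T (fun i j k => f j i k) = T f := fun f => by
    simp only [hT]
    rw [sum_comm]
    exact sum_congr rfl fun i _ => sum_congr rfl fun j _ => sum_congr rfl fun k _ => by ring
  have T2 : ∀ f, T (fun i j k => f i k j) = T f := fun f => by
    simp only [hT]
    refine sum_congr rfl fun i _ => ?_
    rw [sum_comm]
    exact sum_congr rfl fun j _ => sum_congr rfl fun k _ => by ring
  have T3 : ∀ f, T (fun i j k => f k i j) = T f := fun f =>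
    (T2 (fun i j k => f j i k)).trans (T1 f)
  have Tadd : ∀ f g, T (fun i j k => f i j k + g i j k) = T f + T g := fun f g => by
    simp only [hT, C_add, add_mul, sum_add_distrib]
  have Tadd₃ : ∀ f g h, T (fun i j k => f i j k + g i j k + h i j k) = T f + T g + T h :=
      fun f g h => by
    simp only [hT, C_add, add_mul, sum_add_distrib]
  have Tform : ∀ Q : V → Matrix V V ℝ, ∑ i, X i ^ 2 * squaredForm (Q i) =
      T (fun i j k => Q i j k) := fun Q => by
    simp only [hT, squaredForm, mul_sum]
    exact sum_congr rfl fun i _ => sum_congr rfl fun j _ => sum_congr rfl fun k _ => by ring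
  have hF : (∑ i, X i ^ 2) * squaredForm M = T (fun _ j k => M j k) := by
    rw [sum_mul, Tform fun _ => M]
  set c : V → V → V → ℝ := fun i j k =>
    M i j + M j k + M i k - (P i j k + P j i k + P k i j) with hc
  have key : C 3 * ((∑ i, X i ^ 2) * squaredForm M) =
      C 3 * ∑ i, X i ^ 2 * squaredForm (P i) + T c := by
    have h1 : T (fun i j k => M j k + M i k + M i j) =
        C 3 * ((∑ i, X i ^ 2) * squaredForm M) := by
      rw [Tadd₃ (fun _ j k => M j k) (fun i _ k => M i k) (fun i j _ => M i j), hF,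
        T1 (fun _ j k => M j k), T3 (fun _ j k => M j k)]
      rw [show (C 3 : MvPolynomial V ℝ) = 3 from rfl]; ring
    have h2 : T (fun i j k => P i j k + P j i k + P k i j) =
        C 3 * ∑ i, X i ^ 2 * squaredForm (P i) := by
      rw [Tadd₃ (fun i j k => P i j k) (fun i j k => P j i k) (fun i j k => P k i j), Tform,
        T1 (fun i j k => P i j k), T3 (fun i j k => P i j k)]
      rw [show (C 3 : MvPolynomial V ℝ) = 3 from rfl]; ring
    rw [← h1, ← h2, ← Tadd]
    congr 1
    funext i j k
    rw [hc]; ring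
  have hc0 : IsSumSq (T c) := by
    refine IsSumSq.sum fun i _ => IsSumSq.sum fun j _ => IsSumSq.sum fun k _ => ?_
    refine (isSumSq_C (sub_nonneg.2 (hle i j k))).mul ?_
    rw [show (X i ^ 2 * X j ^ 2 * X k ^ 2 : MvPolynomial V ℝ) =
      (X i * X j * X k) * (X i * X j * X k) by ring]
    exact IsSumSq.mul_self _
  have hP0 : IsSumSq (∑ i, X i ^ 2 * squaredForm (P i)) :=
    IsSumSq.sum fun i _ => IsSumSq.mul (by rw [sq]; exact IsSumSq.mul_self _) (hP i)
  have h3 : (C (1 / 3) : MvPolynomial V ℝ) * C 3 = 1 := by rw [← C_mul]; norm_num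
  have hfin : (∑ i, X i ^ 2) * squaredForm M =
      ∑ i, X i ^ 2 * squaredForm (P i) + C (1 / 3) * T c := by
    calc _ = C (1 / 3) * (C 3 * ((∑ i, X i ^ 2) * squaredForm M)) := by
          rw [← mul_assoc, h3, one_mul]
      _ = _ := by rw [key, mul_add, ← mul_assoc, h3, one_mul]
  rw [pow_one, hfin]
  exact hP0.add ((isSumSq_C (by norm_num)).mul hc0)

end Certificates

/-! ### Graphs with isolated nodes: sufficiency -/

/-- For every vertex `i`, the vertices outside the closed neighbourhood of `i` are covered by `b`
cliques, the fibres of `cls i`. -/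
def SimpleGraph.IsLocallyCliqueCovered {V : Type*} (G : SimpleGraph V) (b : ℕ) : Prop :=
  ∃ cls : V → V → Fin b, ∀ i j k, ¬ (i = j ∨ G.Adj i j) → ¬ (i = k ∨ G.Adj i k) →
    cls i j = cls i k → j = k ∨ G.Adj j k

theorem sum_centered_indicator {b : ℕ} (hb : (b : ℝ) ≠ 0) (c c' : Fin b) :
    ∑ k, ((if c = k then (1 : ℝ) else 0) - 1 / b) * ((if c' = k then 1 else 0) - 1 / b) =
      (if c = c' then 1 else 0) - 1 / b := by
  simp only [sub_mul, mul_sub, sum_sub_distrib, ite_mul, one_mul, zero_mul, sum_ite_eq, mem_univ,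
    if_true, mul_ite, mul_one, mul_zero, sum_const, card_univ, Fintype.card_fin, nsmul_eq_mul]
  field_simp
  ring

section Sufficient

variable {V : Type*} [Fintype V] {m : ℕ}

open Classical in
/-- The matrix attached to an isolated node in the level-one certificate. -/
theorem exists_isolated_certificate (V : Type*) [Fintype V] (m : ℕ) {a : ℝ} (ha : 0 < a) :
    ∃ P : Matrix (V ⊕ Fin m) (V ⊕ Fin m) ℝ, IsSumSq (squaredForm P) ∧
      (∀ j k, P (.inl j) (.inl k) = m / a) ∧
      (∀ j t, P (.inl j) (.inr t) = -1) ∧ (∀ j t, P (.inr t) (.inl j) = -1) ∧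
      ∀ t t', P (.inr t) (.inr t') = (if t = t' then a + m else 0) - 1 := by
  set v : Fin m → V ⊕ Fin m → ℝ := fun s =>
    Sum.elim (fun _ => -1 / a) (fun t => if t = s then 1 else 0) with hv
  set d : Fin m → V ⊕ Fin m → ℝ := fun s =>
    Sum.elim (fun _ => 0) (fun t => (if t = s then 1 else 0) - 1 / m) with hd
  refine ⟨a • ∑ s, Matrix.vecMulVec (v s) (v s) + (m : ℝ) • ∑ s, Matrix.vecMulVec (d s) (d s),
    ?_, ?_, ?_, ?_, ?_⟩
  · rw [squaredForm_add]
    exact (isSumSq_squaredForm_smul_sum ha.le v).add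
      (isSumSq_squaredForm_smul_sum (Nat.cast_nonneg m) d)
  · intro j k
    simp [Matrix.add_apply, Matrix.smul_apply, Matrix.sum_apply, Matrix.vecMulVec_apply, hv, hd]
    field_simp
  · intro j t
    simp [Matrix.add_apply, Matrix.smul_apply, Matrix.sum_apply, Matrix.vecMulVec_apply, hv, hd]
    field_simp
  · intro j t
    simp [Matrix.add_apply, Matrix.smul_apply, Matrix.sum_apply, Matrix.vecMulVec_apply, hv, hd]
    field_simp
  · intro t t'
    have hm : (m : ℝ) ≠ 0 := by
      have := t.pos; positivity
    simp only [Matrix.add_apply, Matrix.smul_apply, Matrix.sum_apply, Matrix.vecMulVec_apply, hv,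
      hd, Sum.elim_inr, sum_centered_indicator hm, smul_eq_mul]
    have : ∑ x, (if t = x then (1 : ℝ) else 0) * (if t' = x then 1 else 0) =
        if t = t' then 1 else 0 := by simp
    rw [this]
    split_ifs <;> field_simp <;> ring

open Classical in
/-- The matrix attached to a vertex `i` of `G` in the level-one certificate. Its entries on `V`
depend only on the blocks formed by the closed neighbourhood `N` of `i` and the `b` cliques covering
the other vertices, and it is a sum of rank-one terms: `e` compares the neighbourhood with the
average of the cliques, `f k` compares the clique `k` with this average, `v s` couples the isolated
node `s` to `V`, and `d s` is `s` minus the average isolated node. The weight of `e` is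
`δ = (α - 1) - m * u₀ ^ 2 / a`, and nonnegativity of `δ` is the hypothesis `hδ`. -/
theorem exists_vertex_certificate {b : ℕ} (hb : 1 ≤ b) (N : V → Prop) (cls : V → Fin b)
    {a α u₀ u₁ w p : ℝ} (ha : a = b + 1) (hα : α = a + m) (hu₀ : u₀ = (α - 3 - m / a) / 2)
    (hu₁ : u₁ = -(3 + m / a) / 2) (hw : w = -1 - m / 2 * (1 + m / a)) (hp : p = α - 3 - 2 * w)
    (hδ : 0 ≤ (α - 1) - m * u₀ ^ 2 / a) :
    ∃ P : Matrix (V ⊕ Fin m) (V ⊕ Fin m) ℝ, IsSumSq (squaredForm P) ∧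
      (∀ j k, P (.inl j) (.inl k) =
        if N j then (if N k then α - 1 else w) else
          if N k then w else if cls j = cls k then p else -1) ∧
      (∀ j t, P (.inl j) (.inr t) = if N j then u₀ else u₁) ∧
      (∀ j t, P (.inr t) (.inl j) = if N j then u₀ else u₁) ∧
      ∀ t t', P (.inr t) (.inr t') = (if t = t' then α else 0) - 1 := by
  have hb0 : (0 : ℝ) < b := by exact_mod_cast hb
  have ha0 : 0 < a := by rw [ha]; positivity
  have hm0 : (0 : ℝ) ≤ m := Nat.cast_nonneg m
  have hp1 : 0 ≤ p + 1 := by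
    have : 0 ≤ m * (1 + m / a) := by positivity
    rw [hp, hw, hα]; linarith
  set δ : ℝ := (α - 1) - m * u₀ ^ 2 / a with hδ'
  set e : Unit → V ⊕ Fin m → ℝ := fun _ =>
    Sum.elim (fun j => if N j then 1 else -1 / b) (fun _ => 0) with he
  set f : Fin b → V ⊕ Fin m → ℝ := fun k =>
    Sum.elim (fun j => if N j then 0 else (if cls j = k then 1 else 0) - 1 / b) (fun _ => 0)
    with hf
  set v : Fin m → V ⊕ Fin m → ℝ := fun s =>
    Sum.elim (fun j => (if N j then u₀ else u₁) / a) (fun t => if t = s then 1 else 0) with hv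
  set d : Fin m → V ⊕ Fin m → ℝ := fun s =>
    Sum.elim (fun _ => 0) (fun t => (if t = s then 1 else 0) - 1 / m) with hd
  refine ⟨δ • ∑ s, Matrix.vecMulVec (e s) (e s) + (p + 1) • ∑ k, Matrix.vecMulVec (f k) (f k) +
    a • ∑ s, Matrix.vecMulVec (v s) (v s) + (m : ℝ) • ∑ s, Matrix.vecMulVec (d s) (d s),
    ?_, ?_, ?_, ?_, ?_⟩
  · rw [squaredForm_add, squaredForm_add, squaredForm_add]
    exact (((isSumSq_squaredForm_smul_sum hδ e).add (isSumSq_squaredForm_smul_sum hp1 f)).add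
      (isSumSq_squaredForm_smul_sum ha0.le v)).add (isSumSq_squaredForm_smul_sum hm0 d)
  · intro j k
    simp only [Matrix.add_apply, Matrix.smul_apply, Matrix.sum_apply, Matrix.vecMulVec_apply, he,
      hf, hv, hd, Sum.elim_inl, smul_eq_mul, sum_const, card_univ, Fintype.card_fin,
      nsmul_eq_mul, Fintype.card_unit, mul_zero, add_zero, Nat.cast_one, one_mul]
    by_cases hj : N j <;> by_cases hk : N k
    · simp only [if_pos hj, if_pos hk, sum_const_zero, mul_zero]
      rw [hδ']; field_simp; ring
    · simp only [if_pos hj, if_neg hk, zero_mul, sum_const_zero, mul_zero]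
      rw [hδ', hw, hu₁, hu₀, hα, ha]; field_simp; ring
    · simp only [if_neg hj, if_pos hk, sum_const_zero, mul_zero]
      rw [hδ', hw, hu₁, hu₀, hα, ha]; field_simp; ring
    · simp only [if_neg hj, if_neg hk, sum_centered_indicator hb0.ne']
      split_ifs <;> rw [hδ', hp, hw, hu₁, hu₀, hα, ha] <;> field_simp <;> ring
  · intro j t
    simp [Matrix.add_apply, Matrix.smul_apply, Matrix.sum_apply, Matrix.vecMulVec_apply, he, hf,
      hv, hd]
    field_simp
  · intro j t
    simp [Matrix.add_apply, Matrix.smul_apply, Matrix.sum_apply, Matrix.vecMulVec_apply, he, hf,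
      hv, hd]
    field_simp
  · intro t t'
    have hm : (m : ℝ) ≠ 0 := by
      have := t.pos; positivity
    have : ∑ x, (if t = x then (1 : ℝ) else 0) * (if t' = x then 1 else 0) =
        if t = t' then 1 else 0 := by simp
    simp only [Matrix.add_apply, Matrix.smul_apply, Matrix.sum_apply, Matrix.vecMulVec_apply, he,
      hf, hv, hd, Sum.elim_inr, sum_centered_indicator hm, smul_eq_mul, this, mul_zero,
      sum_const_zero, zero_add, hα]
    split_ifs <;> field_simp <;> ring

/-- The hypothesis `m * b ≤ 4 * (b + 1)` is what makes the vertex certificates sums of squares; the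
triple inequalities hold with equality except at some triples with repeated or adjacent vertices. -/
theorem mem_parriloCone_one_of_mul_le {G : SimpleGraph V} {b : ℕ} (hb : 1 ≤ b)
    (hG : G.IsLocallyCliqueCovered b) (hm : m * b ≤ 4 * (b + 1)) :
    thetaMatrix (G ⊕g (⊥ : SimpleGraph (Fin m))) ((b + 1 : ℕ) + m) ∈
      parriloCone (V ⊕ Fin m) 1 := by
  classical
  obtain ⟨cls, hcls⟩ := hG
  set a : ℝ := ((b + 1 : ℕ) : ℝ) with ha
  set α : ℝ := a + m with hα
  set u₀ : ℝ := (α - 3 - m / a) / 2 with hu₀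
  set u₁ : ℝ := -(3 + m / a) / 2 with hu₁
  set w : ℝ := -1 - m / 2 * (1 + m / a) with hw
  set p : ℝ := α - 3 - 2 * w with hp
  have hab : a = b + 1 := by rw [ha]; push_cast; ring
  have hb0 : (0 : ℝ) < b := by exact_mod_cast hb
  have ha0 : 0 < a := by rw [hab]; positivity
  have hm0 : (0 : ℝ) ≤ m := Nat.cast_nonneg m
  have hδ : 0 ≤ (α - 1) - m * u₀ ^ 2 / a := by
    have h1 : (α - 1) - m * u₀ ^ 2 / a =
        b * (4 * a - m * b) * (m + a) ^ 2 / (4 * a ^ 3) := by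
      rw [hu₀, hα, hab]; field_simp; ring
    have h2 : 0 ≤ 4 * a - m * b := by
      rw [sub_nonneg, ha]; exact_mod_cast hm
    rw [h1]; positivity
  have hw1 : w ≤ -1 := by
    have : 0 ≤ m / 2 * (1 + m / a) := by positivity
    rw [hw]; linarith
  have hα1 : 1 ≤ α := by rw [hα, hab]; linarith
  choose P hP hP₁ hP₂ hP₃ hP₄ using fun i : V =>
    exists_vertex_certificate (V := V) hb (fun j => i = j ∨ G.Adj i j) (cls i) hab hα hu₀ hu₁ hw
      hp hδ
  obtain ⟨Q, hQ, hQ₁, hQ₂, hQ₃, hQ₄⟩ := exists_isolated_certificate V m ha0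
  have hnear : ∀ i j, (i = j ∨ G.Adj i j) ↔ (j = i ∨ G.Adj j i) := fun i j =>
    or_congr eq_comm (G.adj_comm i j)
  have hM₁ : ∀ i j, thetaMatrix (G ⊕g (⊥ : SimpleGraph (Fin m))) α (.inl i) (.inl j) =
      (if i = j ∨ G.Adj i j then α else 0) - 1 := fun i j => by
    simp [thetaMatrix_apply]
  have hM₂ : ∀ i t, thetaMatrix (G ⊕g (⊥ : SimpleGraph (Fin m))) α (.inl i) (.inr t) = -1 :=
    fun i t => by simp [thetaMatrix_apply]
  have hM₃ : ∀ i t, thetaMatrix (G ⊕g (⊥ : SimpleGraph (Fin m))) α (.inr t) (.inl i) = -1 :=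
    fun i t => by simp [thetaMatrix_apply]
  have hM₄ : ∀ s t, thetaMatrix (G ⊕g (⊥ : SimpleGraph (Fin m))) α (.inr s) (.inr t) =
      (if s = t then α else 0) - 1 := fun s t => by
    simp [thetaMatrix_apply]
  refine mem_parriloCone_one_of_certificate (thetaMatrix_isSymm _ _) (Sum.elim P fun _ => Q)
    (by rintro (i | s) <;> simp [hP, hQ]) ?_
  have e₀ : 2 * u₀ + m / a = α - 3 := by rw [hu₀]; ring
  have e₁ : 2 * u₁ + m / a = -3 := by rw [hu₁]; ring
  rintro (i | r) (j | s) (k | t)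
  · simp only [Sum.elim_inl, hP₁, hM₁, hnear j i, hnear k i, hnear k j]
    have c₁ := hcls i j k
    have c₂ := hcls j i k
    have c₃ := hcls k i j
    simp only [hnear j i, hnear k i, hnear k j] at c₁ c₂ c₃
    -- The cases are the graphs on three vertices. With no edge all three entries are `-1`; with a
    -- single edge the sum is at most `2 * w + p = α - 3`; with more edges `w ≤ -1` suffices.
    by_cases h₁ : i = j ∨ G.Adj i j <;> by_cases h₂ : i = k ∨ G.Adj i k <;>
      by_cases h₃ : j = k ∨ G.Adj j k <;>
      simp only [h₁, h₂, h₃, if_true, if_false, not_true_eq_false, not_false_eq_true,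
        forall_const, imp_false] at c₁ c₂ c₃ ⊢
    all_goals
      try simp only [c₁, c₂, c₃, if_false]
      try split_ifs
      all_goals linarith
  · simp only [Sum.elim_inl, Sum.elim_inr, hP₂, hQ₁, hM₁, hM₂, hnear j i]
    split_ifs <;> linarith
  · simp only [Sum.elim_inl, Sum.elim_inr, hP₂, hP₃, hQ₁, hM₁, hM₂, hM₃, hnear k i]
    split_ifs <;> linarith
  · simp only [Sum.elim_inl, Sum.elim_inr, hP₄, hQ₂, hM₂, hM₄]
    linarith
  · simp only [Sum.elim_inl, Sum.elim_inr, hP₃, hQ₁, hM₁, hM₃, hnear k j]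
    split_ifs <;> linarith
  · simp only [Sum.elim_inl, Sum.elim_inr, hP₄, hQ₂, hQ₃, hM₂, hM₃, hM₄]
    linarith
  · simp only [Sum.elim_inl, Sum.elim_inr, hP₄, hQ₃, hM₃, hM₄]
    linarith
  · simp only [Sum.elim_inr, hQ₄, hM₄]
    linarith

end Sufficient

/-! ### The theta rank in the presence of isolated nodes -/

/-- A stable set containing `i` has at most one further vertex in each clique covering the
non-neighbours of `i`. -/
theorem card_le_of_isLocallyCliqueCovered {V : Type*} {G : SimpleGraph V} {b : ℕ}
    (hG : G.IsLocallyCliqueCovered b) {S : Finset V} (hS : G.IsIndepSet S) : #S ≤ b + 1 := by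
  classical
  obtain ⟨cls, hcls⟩ := hG
  rcases S.eq_empty_or_nonempty with rfl | ⟨i, hi⟩
  · simp
  rw [← card_erase_add_one hi]
  have hfar : ∀ j ∈ S.erase i, ¬ (i = j ∨ G.Adj i j) := fun j hj => by
    rw [mem_erase] at hj
    rintro (h | h)
    · exact hj.1 h.symm
    · exact hS hi hj.2 hj.1.symm h
  have : #(S.erase i) ≤ #(univ : Finset (Fin b)) := by
    refine card_le_card_of_injOn (cls i) (fun _ _ => mem_coe.2 (mem_univ _)) fun j hj k hk h => ?_
    rcases hcls i j k (hfar j hj) (hfar k hk) h with h | h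
    · exact h
    · by_contra hne
      exact hS (mem_of_mem_erase hj) (mem_of_mem_erase hk) hne h
  simpa using this

theorem indepNum_sum_bot {V : Type*} [Fintype V] {G : SimpleGraph V} {b m : ℕ}
    (hG : G.IsLocallyCliqueCovered b) {S₀ : Finset V} (hS₀ : G.IsIndepSet S₀)
    (hcard : #S₀ = b + 1) :
    (G ⊕g (⊥ : SimpleGraph (Fin m))).indepNum = b + 1 + m := by
  classical
  apply le_antisymm
  · obtain ⟨S, hS⟩ := (G ⊕g (⊥ : SimpleGraph (Fin m))).exists_isNIndepSet_indepNum
    rw [← hS.2, ← card_toLeft_add_card_toRight]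
    refine add_le_add (card_le_of_isLocallyCliqueCovered hG ?_)
      ((card_le_univ _).trans_eq (Fintype.card_fin m))
    intro i hi j hj hij
    have := hS.1 (mem_toLeft.1 hi) (mem_toLeft.1 hj) (by simpa using hij)
    simpa using this
  · have := (isIndepSet_disjSum hS₀ (univ : Finset (Fin m))).card_le_indepNum
    rwa [card_disjSum, hcard, card_univ, Fintype.card_fin] at this

section Rank

variable {V : Type*} [Fintype V] {G : SimpleGraph V} {b : ℕ}

theorem not_isTheta_zero_sum_bot (hb : 1 ≤ b) (hG : G.IsLocallyCliqueCovered b)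
    (hrigid : G.IsStableRigid (b + 1)) (hS : ∃ S₀ : Finset V, G.IsIndepSet S₀ ∧ #S₀ = b + 1)
    (m : ℕ) :
    ¬ IsTheta (G ⊕g (⊥ : SimpleGraph (Fin m))) 0
      (G ⊕g (⊥ : SimpleGraph (Fin m))).indepNum := by
  obtain ⟨S₀, hS₀, hcard⟩ := hS
  have hα := indepNum_sum_bot (m := m) hG hS₀ hcard
  rw [isTheta_indepNum_iff _ _ (by omega), hα, Nat.cast_add]
  exact not_mem_parriloCone_zero (by omega) hrigid hS₀ hcard

/-- Under the two conditions on `G`, with `b + 1 ≥ 2` its stability number, level one is exact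
precisely when `m * b ≤ 4 * (b + 1)`, while level zero never is. -/
theorem thetaRank_sum_bot_eq_one_iff (hb : 1 ≤ b) (hG : G.IsLocallyCliqueCovered b)
    (hrigid : G.IsStableRigid (b + 1)) (hS : ∃ S₀ : Finset V, G.IsIndepSet S₀ ∧ #S₀ = b + 1)
    (m : ℕ) :
    thetaRank (G ⊕g (⊥ : SimpleGraph (Fin m))) = 1 ↔ m * b ≤ 4 * (b + 1) := by
  rw [thetaRank_eq_one_iff _ (not_isTheta_zero_sum_bot hb hG hrigid hS m)]
  obtain ⟨S₀, hS₀, hcard⟩ := hS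
  have hα := indepNum_sum_bot (m := m) hG hS₀ hcard
  rw [isTheta_indepNum_iff _ _ (by omega), hα, Nat.cast_add]
  exact ⟨mul_le_of_mem_parriloCone_one hb hrigid hS₀ hcard, mem_parriloCone_one_of_mul_le hb hG⟩

theorem two_le_thetaRank_sum_bot (hb : 1 ≤ b) (hG : G.IsLocallyCliqueCovered b)
    (hrigid : G.IsStableRigid (b + 1)) (hS : ∃ S₀ : Finset V, G.IsIndepSet S₀ ∧ #S₀ = b + 1)
    {m : ℕ} (hm : 4 * (b + 1) < m * b) :
    2 ≤ thetaRank (G ⊕g (⊥ : SimpleGraph (Fin m))) := by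
  have h0 := not_isTheta_zero_sum_bot hb hG hrigid hS m
  have h1 : ¬ thetaRank (G ⊕g (⊥ : SimpleGraph (Fin m))) ≤ (1 : ℕ) := by
    rw [thetaRank_le_iff]
    rintro ⟨r, hr, h⟩
    interval_cases r
    · exact h0 h
    · have := (thetaRank_sum_bot_eq_one_iff hb hG hrigid hS m).1
        ((thetaRank_eq_one_iff _ h0).2 h)
      omega
  have := Order.add_one_le_of_lt (not_le.1 h1)
  rwa [Nat.cast_one, one_add_one_eq_two] at this

end Rank

/-! ### Odd cycles and their complements -/

theorem cycleGraph_odd_adj_iff {n : ℕ} (hn : 1 ≤ n) (u v : Fin (2 * n + 1)) :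
    (SimpleGraph.cycleGraph (2 * n + 1)).Adj u v ↔
      u.val + 1 = v.val ∨ v.val + 1 = u.val ∨ (u.val = 0 ∧ v.val = 2 * n) ∨
        (v.val = 0 ∧ u.val = 2 * n) := by
  have hsub : ∀ x y : Fin (2 * n + 1), (x - y).val = 1 ↔
      y.val + 1 = x.val ∨ (x.val = 0 ∧ y.val = 2 * n) := by
    intro x y
    have hx := x.isLt
    have hy := y.isLt
    rcases le_or_gt y x with h | h
    · rw [Fin.sub_val_of_le h]
      have : y.val ≤ x.val := h
      omega
    · rw [Fin.coe_sub_iff_lt.2 h]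
      have : x.val < y.val := h
      omega
  rw [SimpleGraph.cycleGraph_adj', hsub, hsub]
  omega

theorem cycleGraph_isLocallyCliqueCovered {b : ℕ} (hb : 1 ≤ b) :
    (SimpleGraph.cycleGraph (2 * (b + 1) + 1)).IsLocallyCliqueCovered b := by
  -- The vertex at clockwise distance `d` from `i` lies in the edge with index `d / 2 - 1`.
  set d : Fin (2 * (b + 1) + 1) → Fin (2 * (b + 1) + 1) → ℕ := fun i j =>
    if i.val ≤ j.val then j.val - i.val else j.val + (2 * (b + 1) + 1) - i.val with hd
  refine ⟨fun i j => ⟨min (d i j / 2 - 1) (b - 1), by omega⟩, fun i j k hij hik h => ?_⟩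
  have far : ∀ i j : Fin (2 * (b + 1) + 1),
      ¬ (i = j ∨ (SimpleGraph.cycleGraph (2 * (b + 1) + 1)).Adj i j) →
      2 ≤ d i j ∧ d i j ≤ 2 * b + 1 := by
    intro i j h
    have := i.isLt
    have := j.isLt
    rw [cycleGraph_odd_adj_iff (by omega), Fin.ext_iff] at h
    simp only [hd]
    split_ifs <;> omega
  have h1 := far i j hij
  have h2 := far i k hik
  have h3 : d i j / 2 = d i k / 2 := by
    simp only [Fin.mk.injEq] at h
    omega
  have h4 : d i j = d i k ∨ d i j + 1 = d i k ∨ d i k + 1 = d i j := by omega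
  have := i.isLt
  have := j.isLt
  have := k.isLt
  rw [cycleGraph_odd_adj_iff (by omega), Fin.ext_iff]
  clear hij hik h h1 h2 h3 far
  simp only [hd] at h4
  split_ifs at h4 <;> omega

theorem compl_cycleGraph_isLocallyCliqueCovered {n : ℕ} (hn : 2 ≤ n) :
    (SimpleGraph.cycleGraph (2 * n + 1))ᶜ.IsLocallyCliqueCovered 1 := by
  refine ⟨fun _ _ => 0, fun i j k hij hik _ => ?_⟩
  have hi := i.isLt
  have hj := j.isLt
  have hk := k.isLt
  simp only [SimpleGraph.compl_adj, cycleGraph_odd_adj_iff (show 1 ≤ n by omega), ne_eq,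
    Fin.ext_iff] at *
  omega

/-- The maximum stable sets of the odd cycle, listed increasingly: the gaps between consecutive
elements are `2`, apart from one gap of `3`, which is placed before the element of index `t`
(and is the gap across `0` when `t = 0` or `n ≤ t`). -/
def oddCycleStable (n : ℕ) (e : Fin 2) (t : ℕ) (k : Fin n) : Fin (2 * n + 1) :=
  ⟨2 * k + e + if t ≤ k then 1 else 0, by split_ifs <;> omega⟩

theorem oddCycleStable_injective (n : ℕ) (e : Fin 2) (t : ℕ) :
    Function.Injective (oddCycleStable n e t) := by
  intro k l h
  simp only [oddCycleStable, Fin.mk.injEq] at h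
  ext
  split_ifs at h <;> omega

theorem isIndepSet_oddCycleStable {n : ℕ} (hn : 1 ≤ n) (e : Fin 2) (t : ℕ) :
    (SimpleGraph.cycleGraph (2 * n + 1)).IsIndepSet
      (univ.map ⟨oddCycleStable n e t, oddCycleStable_injective n e t⟩ :
        Finset (Fin (2 * n + 1))) := by
  intro u hu v hv huv
  simp only [coe_map, coe_univ, Set.image_univ, Set.mem_range, Function.Embedding.coeFn_mk]
    at hu hv
  obtain ⟨k, rfl⟩ := hu
  obtain ⟨l, rfl⟩ := hv
  have hkl : k.val ≠ l.val := fun h => huv (by rw [Fin.ext h])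
  have hval : ∀ x, (oddCycleStable n e t x).val = 2 * x + e + if t ≤ x then 1 else 0 :=
    fun _ => rfl
  have := e.isLt
  have := k.isLt
  have := l.isLt
  rw [cycleGraph_odd_adj_iff hn, hval, hval]
  by_cases hk : t ≤ k <;> by_cases hl : t ≤ l <;> simp only [hk, hl, if_true, if_false] <;> omega

theorem Fin.eq_of_forall_succ {α : Type*} {N : ℕ} {L : Fin (N + 1) → α}
    (h : ∀ k : ℕ, ∀ hk : k < N, L ⟨k, by omega⟩ = L ⟨k + 1, by omega⟩) (i j : Fin (N + 1)) :
    L i = L j := by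
  have h0 : ∀ k : ℕ, ∀ hk : k < N + 1, L ⟨k, hk⟩ = L 0 := by
    intro k
    induction k with
    | zero => intro _; rfl
    | succ k ih => intro hk; rw [← h k (by omega), ih]
  rw [h0 i i.isLt, h0 j j.isLt]

theorem cycleGraph_isStableRigid {n : ℕ} (hn : 1 ≤ n) :
    (SimpleGraph.cycleGraph (2 * n + 1)).IsStableRigid n := by
  intro L c h
  refine Fin.eq_of_forall_succ fun k hk => ?_
  have hsum : ∀ e t, ∑ l, L (oddCycleStable n e t l) = c := fun e t => by
    have := h _ (isIndepSet_oddCycleStable hn e t) (by simp)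
    simpa using this
  -- The stable sets for `t = k / 2 + 1` and `t = k / 2` differ in exchanging `k` for `k + 1`.
  set e : Fin 2 := ⟨k % 2, by omega⟩ with he
  set l₀ : Fin n := ⟨k / 2, by omega⟩ with hl₀
  have h1 := (hsum e (k / 2 + 1)).trans (hsum e (k / 2)).symm
  rw [← add_sum_erase _ _ (mem_univ l₀), ← add_sum_erase _ _ (mem_univ l₀),
    sum_congr rfl fun l hl => ?_] at h1
  · have h2 := add_right_cancel h1
    convert h2 using 2
    · ext; simp only [oddCycleStable, he, hl₀]; split_ifs <;> omega
    · ext; simp only [oddCycleStable, he, hl₀]; split_ifs <;> omega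
  · have hne : l.val ≠ k / 2 := fun h => (mem_erase.1 hl).1 (Fin.ext h)
    congr 1
    ext
    simp only [oddCycleStable]
    split_ifs <;> omega

theorem exists_isIndepSet_cycleGraph {n : ℕ} (hn : 1 ≤ n) :
    ∃ S : Finset (Fin (2 * n + 1)), (SimpleGraph.cycleGraph (2 * n + 1)).IsIndepSet S ∧ #S = n :=
  ⟨_, isIndepSet_oddCycleStable hn 0 0, by simp⟩

theorem isIndepSet_compl_cycleGraph_pair {n : ℕ} {i j : Fin (2 * n + 1)}
    (h : (SimpleGraph.cycleGraph (2 * n + 1)).Adj i j) :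
    (SimpleGraph.cycleGraph (2 * n + 1))ᶜ.IsIndepSet ({i, j} : Finset (Fin (2 * n + 1))) := by
  intro u hu v hv huv
  simp only [coe_insert, coe_singleton, Set.mem_insert_iff, Set.mem_singleton_iff] at hu hv
  rw [SimpleGraph.compl_adj, not_and_not_right]
  intro _
  rcases hu with rfl | rfl <;> rcases hv with rfl | rfl
  · exact absurd rfl huv
  · exact h
  · exact h.symm
  · exact absurd rfl huv

theorem exists_isIndepSet_compl_cycleGraph {n : ℕ} (hn : 1 ≤ n) :
    ∃ S : Finset (Fin (2 * n + 1)),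
      (SimpleGraph.cycleGraph (2 * n + 1))ᶜ.IsIndepSet S ∧ #S = 1 + 1 := by
  have h : (SimpleGraph.cycleGraph (2 * n + 1)).Adj ⟨0, by omega⟩ ⟨1, by omega⟩ := by
    rw [cycleGraph_odd_adj_iff hn]; simp
  exact ⟨_, isIndepSet_compl_cycleGraph_pair h, card_pair h.ne⟩

theorem compl_cycleGraph_isStableRigid {n : ℕ} (hn : 1 ≤ n) :
    (SimpleGraph.cycleGraph (2 * n + 1))ᶜ.IsStableRigid (1 + 1) := by
  intro L c h
  have hadj : ∀ i j, (SimpleGraph.cycleGraph (2 * n + 1)).Adj i j → L i + L j = c :=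
    fun i j hij => by
      rw [← h _ (isIndepSet_compl_cycleGraph_pair hij) (card_pair hij.ne), sum_pair hij.ne]
  have hstep : ∀ k : ℕ, ∀ hk : k < 2 * n,
      L ⟨k, by omega⟩ + L ⟨k + 1, by omega⟩ = c := fun k hk =>
    hadj _ _ (by rw [cycleGraph_odd_adj_iff hn]; simp)
  -- Values alternate along the path `0, …, 2 * n`, whose length is even.
  have heven : ∀ k : ℕ, ∀ hk : 2 * k ≤ 2 * n, L ⟨2 * k, by omega⟩ = L 0 := by
    intro k
    induction k with
    | zero => intro _; rfl
    | succ k ih =>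
      intro hk
      have h1 := hstep (2 * k) (by omega)
      have h2 := hstep (2 * k + 1) (by omega)
      have h3 := ih (by omega)
      have h4 : L ⟨2 * (k + 1), by omega⟩ = L ⟨2 * k + 1 + 1, by omega⟩ := rfl
      linarith
  have hlast : L ⟨2 * n, by omega⟩ + L 0 = c :=
    hadj _ _ (by rw [cycleGraph_odd_adj_iff hn]; simp)
  have hlast' := heven n le_rfl
  have hall : ∀ k : ℕ, ∀ hk : k < 2 * n + 1, L ⟨k, hk⟩ = c / 2 := by
    intro k
    induction k with
    | zero =>
      intro _
      have : L ⟨0, by omega⟩ = L 0 := rfl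
      linarith
    | succ k ih =>
      intro hk
      have h1 := hstep k (by omega)
      have h2 := ih (by omega)
      linarith
  intro i j
  rw [hall i i.isLt, hall j j.isLt]

theorem thetaRank_cycleGraph_sum_bot_eq_one_iff {n : ℕ} (hn : 2 ≤ n) (m : ℕ) :
    thetaRank (SimpleGraph.cycleGraph (2 * n + 1) ⊕g (⊥ : SimpleGraph (Fin m))) = 1 ↔
      m * (n - 1) ≤ 4 * n := by
  obtain ⟨b, rfl⟩ : ∃ b, n = b + 1 := ⟨n - 1, by omega⟩
  rw [thetaRank_sum_bot_eq_one_iff (by omega) (cycleGraph_isLocallyCliqueCovered (by omega))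
    (cycleGraph_isStableRigid (by omega)) (exists_isIndepSet_cycleGraph (by omega)),
    Nat.add_sub_cancel]

theorem thetaRank_compl_cycleGraph_sum_bot_eq_one_iff {n : ℕ} (hn : 2 ≤ n) (m : ℕ) :
    thetaRank ((SimpleGraph.cycleGraph (2 * n + 1))ᶜ ⊕g (⊥ : SimpleGraph (Fin m))) = 1 ↔
      m ≤ 8 := by
  rw [thetaRank_sum_bot_eq_one_iff le_rfl (compl_cycleGraph_isLocallyCliqueCovered hn)
    (compl_cycleGraph_isStableRigid (by omega)) (exists_isIndepSet_compl_cycleGraph (by omega)),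
    mul_one]

/-- The disjoint union of two edgeless graphs is edgeless. -/
def botSumBotIso (m k : ℕ) :
    ((⊥ : SimpleGraph (Fin m)) ⊕g (⊥ : SimpleGraph (Fin k))) ≃g
      (⊥ : SimpleGraph (Fin (m + k))) where
  toEquiv := finSumFinEquiv
  map_rel_iff' := by rintro (a | a) (b | b) <;> simp

theorem mainTheorem2 :
    (∀ n : ℕ, 2 ≤ n → ∀ m : ℕ,
      (thetaRank (SimpleGraph.cycleGraph (2 * n + 1) ⊕g (SimpleGraph.completeGraph (Fin m))ᶜ) = 1
        ↔ (m : ℝ) ≤ 4 + 4 / ((n : ℝ) - 1)) ∧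
      (thetaRank ((SimpleGraph.cycleGraph (2 * n + 1))ᶜ ⊕g
          (SimpleGraph.completeGraph (Fin m))ᶜ) = 1
        ↔ m ≤ 8)) ∧
    thetaRank (SimpleGraph.cycleGraph 5 ⊕g (SimpleGraph.completeGraph (Fin 8))ᶜ) = 1 ∧
    2 ≤ thetaRank (SimpleGraph.cycleGraph 5 ⊕g (SimpleGraph.completeGraph (Fin 9))ᶜ) ∧
    ¬ (∀ k : ℕ, 1 ≤ k → ∀ G : SimpleGraph (Fin k),
        thetaRank (G ⊕g (⊥ : SimpleGraph (Fin 1))) ≤ thetaRank G) := by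
  have hbot : ∀ m, (SimpleGraph.completeGraph (Fin m))ᶜ = ⊥ := fun m => by
    rw [SimpleGraph.completeGraph_eq_top, compl_top]
  simp only [hbot]
  have h8 : thetaRank (SimpleGraph.cycleGraph 5 ⊕g (⊥ : SimpleGraph (Fin 8))) = 1 :=
    (thetaRank_cycleGraph_sum_bot_eq_one_iff le_rfl 8).2 (by norm_num)
  have h9 : 2 ≤ thetaRank (SimpleGraph.cycleGraph 5 ⊕g (⊥ : SimpleGraph (Fin 9))) :=
    two_le_thetaRank_sum_bot le_rfl (cycleGraph_isLocallyCliqueCovered le_rfl)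
      (cycleGraph_isStableRigid one_le_two) (exists_isIndepSet_cycleGraph one_le_two)
      (by norm_num)
  refine ⟨fun n hn m => ⟨?_, thetaRank_compl_cycleGraph_sum_bot_eq_one_iff hn m⟩, h8, h9, ?_⟩
  · rw [thetaRank_cycleGraph_sum_bot_eq_one_iff hn]
    have hn' : (0 : ℝ) < (n : ℝ) - 1 := by
      have : (2 : ℝ) ≤ n := by exact_mod_cast hn
      linarith
    have he : 4 + 4 / ((n : ℝ) - 1) = 4 * n / ((n : ℝ) - 1) := by
      field_simp; ring
    rw [he, le_div_iff₀ hn', ← Nat.cast_le (α := ℝ)]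
    push_cast [Nat.cast_sub (show 1 ≤ n by omega)]
    rfl
  · intro hmono
    have hiso := SimpleGraph.Iso.comap (finSumFinEquiv (m := 5) (n := 8)).symm
      (SimpleGraph.cycleGraph 5 ⊕g (⊥ : SimpleGraph (Fin 8)))
    have h1 := hmono 13 (by norm_num) (SimpleGraph.comap
      (finSumFinEquiv (m := 5) (n := 8)).symm
      (SimpleGraph.cycleGraph 5 ⊕g (⊥ : SimpleGraph (Fin 8))))
    rw [thetaRank_eq_of_iso hiso, h8, thetaRank_eq_of_iso (((SimpleGraph.Iso.sumCongr hiso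
      SimpleGraph.Iso.refl).trans SimpleGraph.Iso.sumAssoc).trans
      (SimpleGraph.Iso.sumCongr SimpleGraph.Iso.refl (botSumBotIso 8 1)))] at h1
    exact absurd (h9.trans h1) (by decide)
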